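/- Let $N$ be the number of frequency modes. A *50:50 beamsplitter* between two distinct modes is the fixed matrix $\frac1{\sqrt2}\begin{pmatrix}1&i\\ i&1\end{pmatrix}$ on these modes and the identity on the others. A *phase shifter* with phase $\varphi:\mathbb R\to\mathbb R$ multiplies one mode by $e^{i\varphi(\omega)}$. A *chain of cavities* multiplies one mode by a finite product of all-pass factors $\frac{\gamma_k+i(\omega+\Delta_k)}{\gamma_k-i(\omega+\Delta_k)}$ with $\gamma_k>0$, $\Delta_k\in\mathbb R$. A *mesh* is a finite sequence of beamsplitters and single-mode devices; its transfer matrix is the product of theirs. 1. Let $U:\mathbb R\to U(N)$ be any smooth (respectively real-analytic) unitary-matrix-valued function of $\omega$. Then there is a mesh of 50:50 beamsplitters and phase shifters with smooth (respectively real-analytic) phases whose transfer matrix is exactly $U(\omega)$ for all $\omega\in\mathbb R$. Each of its phase shifters is approximated by chains of cavities up to the response of a reference chain: for every band $[a,b]$ and $\varepsilon>0$ there are chains with responses $c(\omega)$, $d(\omega)$ such that $|c(\omega)-d(\omega)e^{i\varphi(\omega)}|<\varepsilon$ on $[a,b]$. Moreover, for every $[a,b]$ and $\varepsilon>0$ there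 are a mesh of 50:50 beamsplitters and chains of cavities, with transfer matrix $V(\omega)$, and a chain with response $d(\omega)$, common to all modes, such that every entry of $V(\omega)-d(\omega)U(\omega)$ has modulus less than $\varepsilon$ on $[a,b]$. 2. Let $U_{\mathrm{IME}}(\omega)$ be the transfer function of a passive linear system, $U_{\mathrm{IME}}(\omega)=\sqrt{2\Gamma}\,(\Gamma+iG-i\omega)^{-1}\sqrt{2\Gamma}-I$ with $G$ an $N\times N$ Hermitian matrix and $\Gamma$ a diagonal matrix with positive diagonal (the input-output relation of $\dot a=(-\Gamma-iG)a+\sqrt{2\Gamma}\,a_{\mathrm{in}}$, $a_{\mathrm{in}}+a_{\mathrm{out}}=\sqrt{2\Gamma}\,a$), or a finite product (cascade) of such functions. Then there is a mesh of 50:50 beamsplitters and phase shifters with real-analytic phases whose transfer matrix is exactly $U_{\mathrm{IME}}(\omega)$ for all $\omega\in\mathbb R$ and in which, for every $[a,b]$ and $\varepsilon>0$, each phase shifter can be replaced by a chain of cavities, on the same mode and with response within $\varepsilon$ of $e^{i\varphi(\omega)}$ on $[a,b]$, so that the resulting mesh of 50:50 beamsplitters and chains of cavities has a transfer matrix which differs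 from $U_{\mathrm{IME}}(\omega)$ by less than $\varepsilon$ in every entry on $[a,b]$. -/

import Mathlib

open scoped ContDiff

noncomputable section

namespace FrequencyMesh

/-- The fixed 50:50 beamsplitter between the modes `m` and `n`: the matrix
`(1/√2) * [[1, i], [i, 1]]` on these two modes and the identity on all the others. -/
def beamSplitter {N : ℕ} (m n : Fin N) : Matrix (Fin N) (Fin N) ℂ :=
  Matrix.of fun i j =>
    if (i = m ∧ j = m) ∨ (i = n ∧ j = n) then ((1 / Real.sqrt 2 : ℝ) : ℂ)
    else if (i = m ∧ j = n) ∨ (i = n ∧ j = m) then Complex.I * ((1 / Real.sqrt 2 : ℝ) : ℂ)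
    else if i = j then 1 else 0

/-- The transformation which multiplies mode `m` by `z` and leaves the other modes unchanged. -/
def onMode {N : ℕ} (m : Fin N) (z : ℂ) : Matrix (Fin N) (Fin N) ℂ :=
  Matrix.diagonal fun i => if i = m then z else 1

/-- One element of a mesh on `N` modes: a fixed 50:50 beamsplitter between two distinct modes, or
a single-mode device of type `P` placed on one mode. -/
inductive Element (N : ℕ) (P : Type) where
  | splitter (m n : Fin N) (hmn : m ≠ n) : Element N P
  | single (m : Fin N) (p : P) : Element N P

/-- The transfer matrix of an element at frequency `w`, when the single-mode device `p`
has the response `resp p w`. -/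
def Element.transfer {N : ℕ} {P : Type} (resp : P → ℝ → ℂ) (w : ℝ) :
    Element N P → Matrix (Fin N) (Fin N) ℂ
  | .splitter m n _ => beamSplitter m n
  | .single m p => onMode m (resp p w)

/-- A mesh is a finite sequence of elements. -/
abbrev Mesh (N : ℕ) (P : Type) : Type := List (Element N P)

/-- The transfer matrix of a mesh is the product of those of its elements. -/
def Mesh.transfer {N : ℕ} {P : Type} (resp : P → ℝ → ℂ) (M : Mesh N P) (w : ℝ) :
    Matrix (Fin N) (Fin N) ℂ :=
  (M.map (Element.transfer resp w)).prod

/-- Every single-mode device of the mesh has the property `Q`. -/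
def Mesh.AllSingle {N : ℕ} {P : Type} (Q : P → Prop) (M : Mesh N P) : Prop :=
  ∀ (m : Fin N) (p : P), Element.single m p ∈ M → Q p

/-- The response `exp (i φ(w))` of a frequency-dependent phase shifter with phase `φ`. -/
def shifterResponse (φ : ℝ → ℝ) (w : ℝ) : ℂ :=
  Complex.exp (Complex.I * (φ w : ℂ))

/-- A single-mode cavity, with damping `γ > 0` and detuning `Δ`. -/
structure Cavity where
  γ : ℝ
  γ_pos : 0 < γ
  Δ : ℝ

/-- The all-pass response `(γ + i(w + Δ)) / (γ - i(w + Δ))` of a single-mode cavity. -/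
def Cavity.response (c : Cavity) (w : ℝ) : ℂ :=
  ((c.γ : ℂ) + Complex.I * ((w : ℂ) + (c.Δ : ℂ))) /
    ((c.γ : ℂ) - Complex.I * ((w : ℂ) + (c.Δ : ℂ)))

/-- The response of a linear chain of single-mode cavities. -/
def chainResponse (C : List Cavity) (w : ℝ) : ℂ :=
  (C.map fun c => c.response w).prod

/-- The mesh element `e'` is `e`, with a phase shifter replaced by a cavity chain on the same mode
whose response is within `ε` of that of the phase shifter on the whole band `[a, b]`. -/
inductive Replaces {N : ℕ} (a b ε : ℝ) : Element N (ℝ → ℝ) → Element N (List Cavity) → Prop where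
  | splitter (m n : Fin N) (hmn : m ≠ n) :
      Replaces a b ε (Element.splitter m n hmn) (Element.splitter m n hmn)
  | single (m : Fin N) (φ : ℝ → ℝ) (C : List Cavity)
      (h : ∀ w ∈ Set.Icc a b, ‖chainResponse C w - shifterResponse φ w‖ < ε) :
      Replaces a b ε (Element.single m φ) (Element.single m C)

/-- A passive linear system of `N` coupled cavity modes, with the quantum Langevin equations
`da/dt = (-Γ - iG) a + √(2Γ) a_in`, `a_in + a_out = √(2Γ) a`: the Hamiltonian is
`∑ G m n a_m† a_n` with `G` Hermitian (no pair production terms), and `Γ` is the diagonal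
matrix of the positive damping rates. -/
structure PassiveSystem (N : ℕ) where
  G : Matrix (Fin N) (Fin N) ℂ
  G_herm : G.IsHermitian
  γ : Fin N → ℝ
  γ_pos : ∀ m, 0 < γ m

/-- The transfer function `√(2Γ) (Γ + iG - iw)⁻¹ √(2Γ) - 1` of a passive system, from `a_in` to
`a_out`, in the Fourier convention in which `d/dt` becomes `-iw` (for `N = 1` and `G = -Δ` it is
the response of a single-mode cavity). -/
def PassiveSystem.transfer {N : ℕ} (S : PassiveSystem N) (w : ℝ) : Matrix (Fin N) (Fin N) ℂ :=
  (Matrix.diagonal fun m => ((Real.sqrt (2 * S.γ m) : ℝ) : ℂ)) *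
    ((Matrix.diagonal fun m => (S.γ m : ℂ)) + Complex.I • S.G -
      (Complex.I * (w : ℂ)) • (1 : Matrix (Fin N) (Fin N) ℂ))⁻¹ *
    (Matrix.diagonal fun m => ((Real.sqrt (2 * S.γ m) : ℝ) : ℂ)) - 1

/-- The transfer function of a cascade of passive systems. -/
def cascadeTransfer {N : ℕ} (L : List (PassiveSystem N)) (w : ℝ) : Matrix (Fin N) (Fin N) ℂ :=
  (L.map fun S => S.transfer w).prod

end FrequencyMesh

end

namespace FrequencyMesh

open Matrix

/-! Part 1 is Gaussian elimination by Mach–Zehnder interferometers with phases of the same class as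
`U`. The obstacle is that an entry of a column may vanish at some frequencies, where its phase has
no regular choice. A constant mixing of two entries cures this: the values of the mixing parameter
that create a new zero form curves in `ℂ`, of Hausdorff dimension at most 1, so almost any constant
avoids them (`exists_generic_mixture`). Nowhere vanishing entries have global phases
(`exists_contDiff_phase`), and one entry can then be emptied into another (`Reach.exists_merge`).

A cavity has phase `2 arctan((w + Δ)/γ)`. Reference chains allow subtraction, so difference
quotients in `Δ` and in the slope `1/γ` give all real multiples of `1/(1 + τ w²)` and `w/(1 + τ
w²)`. From these one obtains every monomial on a band (`LineApprox.pow`), and by Weierstrass every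
continuous phase.

Part 2 avoids the reference chain. With drift `M` and coupling `C`, losslessness reads `M + Mᴴ = Cᴴ
* C`. Rotating an eigenvector of `M` into the first basis state splits off a Blaschke–Potapov
factor, which is one cavity between constant unitaries (`realizable_of_triangular`,
`realizable_potapov`). Constant phases are limits of broad cavities (`ChainApprox.const`). -/

/-! ### Algebra of beamsplitters and phase shifters -/

/-- The matrix acting as the `2 × 2` matrix `[[a, b], [c, d]]` on the modes `m`, `n` and as the
identity on the other modes. -/
def twoMode {N : ℕ} (m n : Fin N) (a b c d : ℂ) : Matrix (Fin N) (Fin N) ℂ :=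
  Matrix.of fun i j =>
    if i = m then (if j = m then a else if j = n then b else 0)
    else if i = n then (if j = m then c else if j = n then d else 0)
    else if i = j then 1 else 0

/-- Matrix identities below are checked on an arbitrary vector through this formula, which avoids
case splits on pairs of indices. -/
theorem twoMode_mulVec {N : ℕ} {m n : Fin N} (hmn : m ≠ n) (a b c d : ℂ) (v : Fin N → ℂ)
    (i : Fin N) :
    (twoMode m n a b c d *ᵥ v) i =
      if i = m then a * v m + b * v n else if i = n then c * v m + d * v n else v i := by
  have key : ∀ x y : ℂ, ∑ j, (if j = m then x else if j = n then y else 0) * v j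
      = x * v m + y * v n := by
    intro x y
    have : ∀ j, (if j = m then x else if j = n then y else 0) * v j =
        (if j = m then x * v m else 0) + (if j = n then y * v n else 0) := by
      intro j
      by_cases h1 : j = m
      · subst h1; simp [hmn]
      · by_cases h2 : j = n
        · subst h2; simp [h1]
        · simp [h1, h2]
    simp [this, Finset.sum_add_distrib]
  simp only [ite_mul, zero_mul] at key
  by_cases h1 : i = m
  · simp [twoMode, mulVec, dotProduct, h1, key]
  · by_cases h2 : i = n
    · simp [twoMode, mulVec, dotProduct, h2, key, hmn.symm]
    · simp [twoMode, mulVec, dotProduct, h1, h2]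

theorem twoMode_mul {N : ℕ} {m n : Fin N} (hmn : m ≠ n) (a b c d a' b' c' d' : ℂ) :
    twoMode m n a b c d * twoMode m n a' b' c' d' =
      twoMode m n (a * a' + b * c') (a * b' + b * d') (c * a' + d * c') (c * b' + d * d') := by
  apply Matrix.ext_of_mulVec_single
  intro k
  generalize (Pi.single k (1 : ℂ) : Fin N → ℂ) = v
  rw [← Matrix.mulVec_mulVec]
  funext i
  simp only [twoMode_mulVec hmn, hmn.symm, if_true, if_false]
  split_ifs <;> ring

theorem twoMode_one {N : ℕ} {m n : Fin N} (hmn : m ≠ n) :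
    twoMode m n 1 0 0 1 = (1 : Matrix (Fin N) (Fin N) ℂ) := by
  apply Matrix.ext_of_mulVec_single
  intro k
  generalize (Pi.single k (1 : ℂ) : Fin N → ℂ) = v
  funext i
  rw [twoMode_mulVec hmn, one_mulVec]
  split_ifs with h h' <;> simp_all

theorem beamSplitter_eq_twoMode {N : ℕ} {m n : Fin N} (hmn : m ≠ n) :
    beamSplitter m n = twoMode m n ((1 / Real.sqrt 2 : ℝ) : ℂ)
      (Complex.I * ((1 / Real.sqrt 2 : ℝ) : ℂ)) (Complex.I * ((1 / Real.sqrt 2 : ℝ) : ℂ))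
      ((1 / Real.sqrt 2 : ℝ) : ℂ) := by
  have hnm := hmn.symm
  ext i j
  simp only [beamSplitter, twoMode, Matrix.of_apply]
  by_cases h1 : i = m <;> by_cases h2 : i = n <;> by_cases h3 : j = m <;> by_cases h4 : j = n <;>
    simp_all <;> grind

theorem onMode_eq_twoMode_left {N : ℕ} {m n : Fin N} (hmn : m ≠ n) (z : ℂ) :
    onMode m z = twoMode m n z 0 0 1 := by
  apply Matrix.ext_of_mulVec_single
  intro k
  generalize (Pi.single k (1 : ℂ) : Fin N → ℂ) = v
  funext i
  rw [twoMode_mulVec hmn, onMode, mulVec_diagonal]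
  split_ifs with h h' <;> simp_all

theorem onMode_eq_twoMode_right {N : ℕ} {m n : Fin N} (hmn : m ≠ n) (z : ℂ) :
    onMode n z = twoMode m n 1 0 0 z := by
  apply Matrix.ext_of_mulVec_single
  intro k
  generalize (Pi.single k (1 : ℂ) : Fin N → ℂ) = v
  funext i
  rw [twoMode_mulVec hmn, onMode, mulVec_diagonal]
  split_ifs with h h' <;> simp_all

theorem onMode_mul {N : ℕ} (m : Fin N) (z z' : ℂ) :
    onMode m z * onMode m z' = onMode m (z * z') := by
  rw [onMode, onMode, onMode, diagonal_mul_diagonal]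
  congr 1
  funext i
  split_ifs <;> simp

theorem onMode_one {N : ℕ} (m : Fin N) : onMode m 1 = 1 := by
  simp [onMode]

theorem onMode_mulVec {N : ℕ} (m : Fin N) (z : ℂ) (v : Fin N → ℂ) (i : Fin N) :
    (onMode m z *ᵥ v) i = if i = m then z * v m else v i := by
  rw [onMode, mulVec_diagonal]
  split_ifs with h <;> simp_all

theorem sqrt_two_inv_mul_self :
    ((1 / Real.sqrt 2 : ℝ) : ℂ) * ((1 / Real.sqrt 2 : ℝ) : ℂ) = 1 / 2 := by
  rw [← Complex.ofReal_mul, div_mul_div_comm, Real.mul_self_sqrt (by norm_num)]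
  norm_num

theorem beamSplitter_sq {N : ℕ} {m n : Fin N} (hmn : m ≠ n) :
    beamSplitter m n * beamSplitter m n = twoMode m n 0 Complex.I Complex.I 0 := by
  have h := sqrt_two_inv_mul_self
  have hI := Complex.I_mul_I
  rw [beamSplitter_eq_twoMode hmn, twoMode_mul hmn]
  generalize ((1 / Real.sqrt 2 : ℝ) : ℂ) = s at *
  congr 1
  · linear_combination (s * s) * hI
  · linear_combination (2 * Complex.I) * h
  · linear_combination (2 * Complex.I) * h
  · linear_combination (s * s) * hI

/-- On the two modes the square is `i` times the swap and the fourth power is `-1`. The inverse is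
thus the seventh power, so reversing a mesh needs no new kind of element. -/
theorem beamSplitter_pow_eight {N : ℕ} {m n : Fin N} (hmn : m ≠ n) :
    beamSplitter m n ^ 8 = 1 := by
  rw [show 8 = 2 * 2 * 2 from rfl, pow_mul, pow_mul, pow_two (beamSplitter m n),
    beamSplitter_sq hmn, pow_two, pow_two, twoMode_mul hmn, twoMode_mul hmn, ← twoMode_one hmn]
  simp

theorem beamSplitter_mul_onMode_mul_beamSplitter {N : ℕ} {m n : Fin N} (hmn : m ≠ n) (z : ℂ) :
    beamSplitter m n * onMode m z * beamSplitter m n =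
      twoMode m n ((z - 1) / 2) (Complex.I * (z + 1) / 2) (Complex.I * (z + 1) / 2)
        ((1 - z) / 2) := by
  have h := sqrt_two_inv_mul_self
  have hI := Complex.I_mul_I
  rw [beamSplitter_eq_twoMode hmn, onMode_eq_twoMode_left hmn, twoMode_mul hmn, twoMode_mul hmn]
  generalize ((1 / Real.sqrt 2 : ℝ) : ℂ) = s at *
  congr 1
  · linear_combination (s * s) * hI + (z - 1) * h
  · linear_combination (Complex.I * (z + 1)) * h
  · linear_combination (Complex.I * (z + 1)) * h
  · linear_combination (s * s * z) * hI + (1 - z) * h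

theorem conjTranspose_beamSplitter {N : ℕ} {m n : Fin N} (hmn : m ≠ n) :
    (beamSplitter m n)ᴴ * beamSplitter m n = 1 := by
  have h := sqrt_two_inv_mul_self
  have hI := Complex.I_mul_I
  have hst : (beamSplitter m n)ᴴ = twoMode m n ((1 / Real.sqrt 2 : ℝ) : ℂ)
      (-Complex.I * ((1 / Real.sqrt 2 : ℝ) : ℂ)) (-Complex.I * ((1 / Real.sqrt 2 : ℝ) : ℂ))
      ((1 / Real.sqrt 2 : ℝ) : ℂ) := by
    have hnm := hmn.symm
    have e (x : ℝ) : (starRingEnd ℂ) (x : ℂ) = x := Complex.conj_ofReal x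
    rw [beamSplitter_eq_twoMode hmn]
    generalize (1 / Real.sqrt 2 : ℝ) = s at *
    ext i j
    simp only [twoMode, Matrix.of_apply, conjTranspose_apply]
    by_cases h1 : i = m <;> by_cases h2 : i = n <;> by_cases h3 : j = m <;> by_cases h4 : j = n <;>
      simp_all [eq_comm]
  rw [hst, beamSplitter_eq_twoMode hmn, twoMode_mul hmn, ← twoMode_one hmn]
  generalize ((1 / Real.sqrt 2 : ℝ) : ℂ) = s at *
  congr 1
  · linear_combination (-s * s) * hI + 2 * h
  · ring
  · ring
  · linear_combination (-s * s) * hI + 2 * h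

theorem conjTranspose_onMode {N : ℕ} (m : Fin N) {z : ℂ} (hz : ‖z‖ = 1) :
    (onMode m z)ᴴ * onMode m z = 1 := by
  have : (starRingEnd ℂ) z * z = 1 := by
    rw [mul_comm, Complex.mul_conj, Complex.normSq_eq_norm_sq, hz]; simp
  rw [onMode, diagonal_conjTranspose, diagonal_mul_diagonal, ← diagonal_one]
  congr 1
  funext i
  by_cases h : i = m <;> simp [h, this]

theorem norm_shifterResponse (φ : ℝ → ℝ) (w : ℝ) : ‖shifterResponse φ w‖ = 1 := by
  rw [shifterResponse, mul_comm, Complex.norm_exp_ofReal_mul_I]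

theorem shifterResponse_add (φ ψ : ℝ → ℝ) (w : ℝ) :
    shifterResponse (fun x => φ x + ψ x) w = shifterResponse φ w * shifterResponse ψ w := by
  simp only [shifterResponse, ← Complex.exp_add]
  push_cast
  ring_nf

theorem shifterResponse_neg_mul (φ : ℝ → ℝ) (w : ℝ) :
    shifterResponse (fun x => - φ x) w * shifterResponse φ w = 1 := by
  simp [shifterResponse, ← Complex.exp_add]

theorem Mesh.transfer_append {N : ℕ} {P : Type} (resp : P → ℝ → ℂ) (M M' : Mesh N P) (w : ℝ) :
    Mesh.transfer resp (M ++ M') w = Mesh.transfer resp M w * Mesh.transfer resp M' w := by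
  simp [Mesh.transfer]

theorem Mesh.transfer_cons {N : ℕ} {P : Type} (resp : P → ℝ → ℂ) (e : Element N P) (M : Mesh N P)
    (w : ℝ) : Mesh.transfer resp (e :: M) w = e.transfer resp w * Mesh.transfer resp M w := by
  simp [Mesh.transfer]

theorem Element.transfer_mem_unitaryGroup {N : ℕ} {P : Type} {resp : P → ℝ → ℂ} {w : ℝ}
    (h : ∀ p, ‖resp p w‖ = 1) (e : Element N P) :
    e.transfer resp w ∈ unitaryGroup (Fin N) ℂ := by
  rw [mem_unitaryGroup_iff']
  cases e with
  | splitter m n hmn => exact conjTranspose_beamSplitter hmn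
  | single m p => exact conjTranspose_onMode m (h p)

theorem Mesh.transfer_mem_unitaryGroup {N : ℕ} {P : Type} {resp : P → ℝ → ℂ} {w : ℝ}
    (h : ∀ p, ‖resp p w‖ = 1) (M : Mesh N P) :
    M.transfer resp w ∈ unitaryGroup (Fin N) ℂ := by
  induction M with
  | nil => simp [Mesh.transfer]
  | cons e M ih =>
    rw [Mesh.transfer_cons]
    exact mul_mem (e.transfer_mem_unitaryGroup h) ih

/-! ### Transfer functions realized by meshes -/

/-- `U` is the transfer function of a mesh of 50:50 beamsplitters and phase shifters, the phases
of which satisfy `Q`. -/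
def Realizable {N : ℕ} (Q : (ℝ → ℝ) → Prop) (U : ℝ → Matrix (Fin N) (Fin N) ℂ) : Prop :=
  ∃ M : Mesh N (ℝ → ℝ), M.AllSingle Q ∧ ∀ w, M.transfer shifterResponse w = U w

namespace Realizable

variable {N : ℕ} {Q : (ℝ → ℝ) → Prop} {U V : ℝ → Matrix (Fin N) (Fin N) ℂ}

theorem mem_unitaryGroup (hU : Realizable Q U) (w : ℝ) : U w ∈ unitaryGroup (Fin N) ℂ := by
  obtain ⟨M, -, hM⟩ := hU
  exact hM w ▸ M.transfer_mem_unitaryGroup fun p => norm_shifterResponse p w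

theorem mono {Q' : (ℝ → ℝ) → Prop} (hQ : ∀ φ, Q φ → Q' φ) (hU : Realizable Q U) :
    Realizable Q' U := by
  obtain ⟨M, h, hM⟩ := hU
  exact ⟨M, fun m p hp => hQ _ (h m p hp), hM⟩

theorem one : Realizable Q (fun _ => (1 : Matrix (Fin N) (Fin N) ℂ)) :=
  ⟨[], fun _ _ h => by simp at h, fun _ => by simp [Mesh.transfer]⟩

theorem mul (hU : Realizable Q U) (hV : Realizable Q V) : Realizable Q (fun w => U w * V w) := by
  obtain ⟨M, h, hM⟩ := hU
  obtain ⟨M', h', hM'⟩ := hV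
  refine ⟨M ++ M', fun m p hp => ?_, fun w => ?_⟩
  · rcases List.mem_append.1 hp with hp | hp
    exacts [h m p hp, h' m p hp]
  · rw [Mesh.transfer_append, hM, hM']

theorem beamSplitter {m n : Fin N} (hmn : m ≠ n) :
    Realizable Q (fun _ => FrequencyMesh.beamSplitter m n) :=
  ⟨[.splitter m n hmn], fun _ _ h => by simp at h,
    fun _ => by simp [Mesh.transfer, Element.transfer]⟩

theorem shifter (m : Fin N) {φ : ℝ → ℝ} (hφ : Q φ) :
    Realizable Q (fun w => onMode m (shifterResponse φ w)) := by
  refine ⟨[.single m φ], fun _ p h => ?_, fun _ => by simp [Mesh.transfer, Element.transfer]⟩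
  simp only [List.mem_singleton, Element.single.injEq] at h
  rwa [h.2]

theorem pow (hU : Realizable Q U) (k : ℕ) : Realizable Q (fun w => U w ^ k) := by
  induction k with
  | zero => simpa using one
  | succ k ih => simpa only [pow_succ] using ih.mul hU

/-- Meshes can be run backwards. -/
theorem star (hQ : ∀ φ, Q φ → Q fun x => - φ x) (hU : Realizable Q U) :
    Realizable Q (fun w => (U w)ᴴ) := by
  obtain ⟨M, h, hM⟩ := hU
  -- A realizable left inverse suffices: by unitarity it is the adjoint.
  suffices H : ∃ V : ℝ → Matrix (Fin N) (Fin N) ℂ, Realizable Q V ∧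
      ∀ w, V w * M.transfer shifterResponse w = 1 by
    obtain ⟨V, hV, hVM⟩ := H
    convert! hV using 2 with w
    have hu := M.transfer_mem_unitaryGroup fun p => norm_shifterResponse p w
    rw [mem_unitaryGroup_iff] at hu
    rw [← hM w]
    calc _ = (V w * M.transfer shifterResponse w) * (M.transfer shifterResponse w)ᴴ := by
          rw [hVM, one_mul]
      _ = V w := by rw [mul_assoc]; erw [hu]; rw [mul_one]
  clear hM
  induction M with
  | nil => exact ⟨_, one, fun w => by simp [Mesh.transfer]⟩
  | cons e M ih =>
    obtain ⟨V, hV, hVM⟩ := ih fun m p hp => h m p (List.mem_cons_of_mem _ hp)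
    have key : ∃ W : ℝ → Matrix (Fin N) (Fin N) ℂ, Realizable Q W ∧
        ∀ w, W w * e.transfer shifterResponse w = 1 := by
      cases e with
      | splitter m n hmn =>
        refine ⟨_, (beamSplitter hmn).pow 7, fun w => ?_⟩
        rw [Element.transfer, ← pow_succ, beamSplitter_pow_eight hmn]
      | single m φ =>
        refine ⟨_, shifter m (hQ φ (h m φ (by simp))), fun w => ?_⟩
        rw [Element.transfer, onMode_mul, shifterResponse_neg_mul, onMode_one]
    obtain ⟨W, hW, hWe⟩ := key
    refine ⟨_, hV.mul hW, fun w => ?_⟩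
    rw [Mesh.transfer_cons, mul_assoc, ← mul_assoc (W w), hWe, one_mul, hVM]

/-- The Mach–Zehnder reflection with angle `θ`. -/
theorem reflection {r : WithTop ℕ∞} {m n : Fin N} (hmn : m ≠ n) {θ : ℝ → ℝ}
    (hθ : ContDiff ℝ r θ) :
    Realizable (ContDiff ℝ r) (fun w => twoMode m n (Real.sin (θ w)) (Real.cos (θ w))
      (Real.cos (θ w)) (-Real.sin (θ w))) := by
  have h1 : ContDiff ℝ r fun w => 2 * θ w := contDiff_const.mul hθ
  -- The interferometer with inner phase `2θ` is `i exp(iθ)` times the reflection; the phase `-π/2 -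
  -- θ` on both modes cancels this factor.
  have h2 : ContDiff ℝ r fun w => -(Real.pi / 2) - θ w := contDiff_const.sub hθ
  convert! (shifter m h2).mul ((shifter n h2).mul
    (((beamSplitter hmn).mul (shifter m h1)).mul (beamSplitter hmn))) using 2 with w
  rw [beamSplitter_mul_onMode_mul_beamSplitter hmn, onMode_eq_twoMode_left hmn,
    onMode_eq_twoMode_right hmn, twoMode_mul hmn, twoMode_mul hmn]
  have e1 : shifterResponse (fun w => 2 * θ w) w =
      Complex.exp (θ w * Complex.I) * Complex.exp (θ w * Complex.I) := by
    rw [shifterResponse, ← Complex.exp_add]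
    push_cast
    ring_nf
  have e2 : shifterResponse (fun w => -(Real.pi / 2) - θ w) w =
      -Complex.I * Complex.exp (-θ w * Complex.I) := by
    rw [shifterResponse, ← Complex.exp_neg_pi_div_two_mul_I, ← Complex.exp_add]
    push_cast
    ring_nf
  have e3 : Complex.exp (-θ w * Complex.I) * Complex.exp (θ w * Complex.I) = 1 := by
    rw [← Complex.exp_add]; simp
  have hI := Complex.I_mul_I
  have hs : (Real.sin (θ w) : ℂ) = (Complex.exp (-θ w * Complex.I) -
      Complex.exp (θ w * Complex.I)) * Complex.I / 2 := by
    rw [Complex.ofReal_sin, Complex.sin]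
  have hc : (Real.cos (θ w) : ℂ) = (Complex.exp (θ w * Complex.I) +
      Complex.exp (-θ w * Complex.I)) / 2 := by
    rw [Complex.ofReal_cos, Complex.cos]
  rw [e1, e2, hs, hc]
  generalize Complex.exp (θ w * Complex.I) = z at *
  generalize Complex.exp (-θ w * Complex.I) = y at *
  congr 1
  · linear_combination (Complex.I * z / 2) * e3
  · linear_combination (y / 2 + y * z * z / 2) * hI - (z / 2) * e3
  · linear_combination (y / 2 + y * z * z / 2) * hI - (z / 2) * e3
  · linear_combination (-Complex.I * z / 2) * e3

end Realizable

theorem Mesh.contDiff_transfer {N : ℕ} {r : WithTop ℕ∞} {M : Mesh N (ℝ → ℝ)}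
    (hM : M.AllSingle (ContDiff ℝ r)) (i j : Fin N) :
    ContDiff ℝ r fun w => M.transfer shifterResponse w i j := by
  induction M generalizing i with
  | nil => simpa [Mesh.transfer] using contDiff_const
  | cons e M ih =>
    simp only [Mesh.transfer_cons, Matrix.mul_apply]
    refine ContDiff.sum fun k _ => ContDiff.mul ?_
      (ih (fun m p hp => hM m p (List.mem_cons_of_mem _ hp)) k)
    cases e with
    | splitter m n hmn => exact contDiff_const
    | single m φ =>
      have hφ : ContDiff ℝ r φ := hM m φ (by simp)
      simp only [Element.transfer, onMode, diagonal_apply]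
      split_ifs
      · exact (contDiff_const.mul (Complex.ofRealCLM.contDiff.comp hφ)).cexp
      · exact contDiff_const
      · exact contDiff_const

theorem Realizable.contDiff {N : ℕ} {r : WithTop ℕ∞} {U : ℝ → Matrix (Fin N) (Fin N) ℂ}
    (hU : Realizable (ContDiff ℝ r) U) (i j : Fin N) : ContDiff ℝ r fun w => U w i j := by
  obtain ⟨M, h, hM⟩ := hU
  simpa only [hM] using Mesh.contDiff_transfer h i j

/-! ### Regular phases and generic mixing -/

/-- A nowhere vanishing smooth curve in `ℂ` has a smooth phase. -/
theorem exists_contDiff_phase {r : WithTop ℕ∞} (hr : 1 ≤ r) {u : ℝ → ℂ} (hu : ContDiff ℝ r u)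
    (h0 : ∀ w, u w ≠ 0) :
    ∃ φ : ℝ → ℝ, ContDiff ℝ r φ ∧ ∀ w, u w = ‖u w‖ * shifterResponse φ w := by
  have hd : Differentiable ℝ u := hu.differentiable (by positivity)
  have hcd : Continuous (deriv u) := hu.continuous_deriv hr
  have hc : Continuous fun w => deriv u w / u w := hcd.div hu.continuous h0
  -- Integrating the logarithmic derivative gives a global logarithm: `u * exp (-F)` has derivative
  -- zero.
  set F : ℝ → ℂ := fun w => ∫ x in (0 : ℝ)..w, deriv u x / u x with hF
  have hFd : ∀ w, HasDerivAt F (deriv u w / u w) w := fun w =>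
    intervalIntegral.integral_hasDerivAt_right (hc.intervalIntegrable _ _)
      (hc.stronglyMeasurableAtFilter _ _) hc.continuousAt
  have hG : ∀ w, HasDerivAt (fun w => u w * Complex.exp (-F w)) 0 w := fun w => by
    have := (hd w).hasDerivAt.mul (hFd w).neg.cexp
    convert! this using 1
    field_simp [h0 w]
    ring
  have hconst : ∀ w, u w = u 0 * Complex.exp (F w) := fun w => by
    have := is_const_of_deriv_eq_zero (fun w => (hG w).differentiableAt) (fun w => (hG w).deriv) w 0
    have hF0 : F 0 = 0 := by simp [hF]
    simp only [hF0, neg_zero, Complex.exp_zero, mul_one] at this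
    rw [← this, mul_assoc, ← Complex.exp_add]
    simp
  set φ : ℝ → ℝ := fun w => (u 0).arg + (F w).im with hφ
  have hφc : Continuous φ := by
    have : Continuous F := continuous_iff_continuousAt.2 fun w => (hFd w).continuousAt
    fun_prop
  have hφu : ∀ w, u w = ‖u w‖ * Complex.exp (Complex.I * φ w) := fun w => by
    have h1 : ‖u w‖ = ‖u 0‖ * Real.exp (F w).re := by
      rw [hconst w, norm_mul, Complex.norm_exp]
    rw [h1]
    conv_lhs => rw [hconst w, ← Complex.norm_mul_exp_arg_mul_I (u 0), ← Complex.re_add_im (F w)]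
    simp only [hφ]
    push_cast
    rw [mul_assoc, mul_assoc, ← Complex.exp_add, ← Complex.exp_add]
    congr 2
    ring
  -- Regularity is local: near `w₀` the phase differs by a constant from the principal `Im log (u w
  -- / u w₀)`, whose argument is near 1. This treats smooth and analytic classes alike.
  refine ⟨φ, contDiff_iff_contDiffAt.2 fun w₀ => ?_, hφu⟩
  have hlog : ContDiffAt ℝ r (fun w => φ w₀ + (Complex.log (u w / u w₀)).im) w₀ := by
    refine contDiffAt_const.add ?_
    change ContDiffAt ℝ r (Complex.imCLM ∘ fun w => Complex.log (u w / u w₀)) w₀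
    refine Complex.imCLM.contDiff.contDiffAt.comp w₀ ?_
    refine ContDiffAt.comp w₀ (g := Complex.log) ?_ (hu.contDiffAt.div_const _)
    refine ContDiffAt.restrict_scalars ℝ (𝕜' := ℂ) (Complex.contDiffAt_log ?_)
    rw [div_self (h0 w₀)]
    exact Complex.one_mem_slitPlane
  refine hlog.congr_of_eventuallyEq ?_
  have hnear : ∀ᶠ w in nhds w₀, φ w - φ w₀ ∈ Set.Ioo (-Real.pi) Real.pi := by
    have : Filter.Tendsto (fun w => φ w - φ w₀) (nhds w₀) (nhds 0) := by
      have := (hφc.tendsto w₀).sub_const (φ w₀)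
      rwa [sub_self] at this
    exact this (Ioo_mem_nhds (by simpa using Real.pi_pos) Real.pi_pos)
  filter_upwards [hnear] with w hw
  rw [Complex.log_im]
  have h1 : u w / u w₀ = ((‖u w‖ / ‖u w₀‖ : ℝ) : ℂ) *
      Complex.exp (((φ w - φ w₀ : ℝ) : ℂ) * Complex.I) := by
    conv_lhs => rw [hφu w, hφu w₀]
    rw [mul_div_mul_comm, ← Complex.exp_sub]
    push_cast
    congr 2
    ring
  have h2 : (0 : ℝ) < ‖u w‖ / ‖u w₀‖ := div_pos (norm_pos_iff.2 (h0 w)) (norm_pos_iff.2 (h0 w₀))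
  rw [h1, Complex.exp_mul_I, Complex.arg_mul_cos_add_sin_mul_I h2 ⟨hw.1, hw.2.le⟩]
  ring

theorem _root_.ContDiffAt.complex_div {r : WithTop ℕ∞} {f g : ℝ → ℂ} {x : ℝ}
    (hf : ContDiffAt ℝ r f x) (hg : ContDiffAt ℝ r g x) (h : g x ≠ 0) :
    ContDiffAt ℝ r (fun w => f w / g w) x := by
  simp only [div_eq_mul_inv]
  exact hf.mul (hg.inv h)

/-- A `C¹` map is locally Lipschitz, so it cannot raise the Hausdorff dimension above that of the
line. -/
theorem dimH_image_le_one {f : ℝ → ℂ} {s : Set ℝ} (hf : ∀ x ∈ s, ContDiffAt ℝ 1 f x) :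
    dimH (f '' s) ≤ 1 := by
  calc dimH (f '' s) ≤ dimH s := dimH_image_le_of_locally_lipschitzOn fun x hx => by
        obtain ⟨K, t, ht, hK⟩ := (hf x hx).exists_lipschitzOnWith
        exact ⟨K, t, mem_nhdsWithin_of_mem_nhds ht, hK⟩
    _ ≤ dimH (Set.univ : Set ℝ) := dimH_mono (Set.subset_univ _)
    _ = 1 := by simpa using Real.dimH_univ_eq_finrank ℝ

/-- Two smooth curves in `ℂ` can be mixed by a constant so that neither mixture vanishes unless
both curves do. -/
theorem exists_generic_mixture {r : WithTop ℕ∞} (hr : 1 ≤ r) {f g : ℝ → ℂ}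
    (hf : ContDiff ℝ r f) (hg : ContDiff ℝ r g) :
    ∃ t : ℂ, t ≠ 0 ∧ ∀ w, (f w + t * g w = 0 ∨ (starRingEnd ℂ) t * f w - g w = 0) →
      f w = 0 ∧ g w = 0 := by
  have hf1 := hf.of_le hr
  have hg1 := hg.of_le hr
  -- `A` and `B` hold the parameters at which one of the two mixtures vanishes although `g`,
  -- respectively `f`, does not. The exclusion of `0` settles the division by `‖t‖` later on.
  set A : Set ℂ := (fun w => -f w / g w) '' {w | g w ≠ 0}
  set B : Set ℂ := (fun w => Complex.conjCLE (g w / f w)) '' {w | f w ≠ 0}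
  have hA : dimH A ≤ 1 := dimH_image_le_one fun x hx =>
    hf1.neg.contDiffAt.complex_div hg1.contDiffAt hx
  have hB : dimH B ≤ 1 := dimH_image_le_one fun x hx =>
    Complex.conjCLE.contDiff.contDiffAt.comp x
      (hg1.contDiffAt.complex_div hf1.contDiffAt hx)
  have hdense : Dense (A ∪ B ∪ {0})ᶜ := by
    apply dense_compl_of_dimH_lt_finrank
    rw [dimH_union, dimH_union, dimH_singleton, Complex.finrank_real_complex]
    exact lt_of_le_of_lt (max_le (max_le hA hB) zero_le_one) (by norm_num)
  obtain ⟨t, ht⟩ := hdense.nonempty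
  simp only [Set.mem_compl_iff, Set.mem_union, Set.mem_singleton_iff, not_or] at ht
  obtain ⟨⟨htA, htB⟩, ht0⟩ := ht
  refine ⟨t, ht0, fun w hw => ?_⟩
  by_contra hne
  rw [not_and_or] at hne
  rcases hw with hw | hw
  · by_cases hgw : g w = 0
    · simp [hgw] at hw hne
      exact hne hw
    · refine htA ⟨w, hgw, ?_⟩
      simp only
      rw [div_eq_iff hgw]
      linear_combination -hw
  · by_cases hfw : f w = 0
    · simp [hfw] at hw hne
      exact hne hw
    · refine htB ⟨w, hfw, ?_⟩
      have : g w / f w = (starRingEnd ℂ) t := by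
        rw [div_eq_iff hfw]
        linear_combination -hw
      simp [this]

/-! ### Elimination of a column and factorization -/

/-- The matrix `A` leaves the modes outside `S` alone. -/
def LocalOn {N : ℕ} (S : Finset (Fin N)) (A : Matrix (Fin N) (Fin N) ℂ) : Prop :=
  ∀ i j, (i ∉ S ∨ j ∉ S) → A i j = (1 : Matrix (Fin N) (Fin N) ℂ) i j

namespace LocalOn

variable {N : ℕ} {S : Finset (Fin N)} {A B : Matrix (Fin N) (Fin N) ℂ}

theorem one : LocalOn S (1 : Matrix (Fin N) (Fin N) ℂ) := fun _ _ _ => rfl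

theorem mul (hA : LocalOn S A) (hB : LocalOn S B) : LocalOn S (A * B) := by
  rintro i j (h | h)
  · rw [← hB i j (.inl h), Matrix.mul_apply]
    simp [hA i _ (.inl h), Matrix.one_apply]
  · rw [← hA i j (.inr h), Matrix.mul_apply]
    simp [hB _ j (.inr h), Matrix.one_apply]

theorem twoMode {m n : Fin N} (hm : m ∈ S) (hn : n ∈ S) (a b c d : ℂ) :
    LocalOn S (twoMode m n a b c d) := by
  intro i j h
  simp only [FrequencyMesh.twoMode, of_apply, one_apply]
  grind

theorem onMode {m : Fin N} (hm : m ∈ S) (z : ℂ) : LocalOn S (onMode m z) := by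
  intro i j h
  simp only [FrequencyMesh.onMode, diagonal_apply, one_apply]
  grind

end LocalOn

/-- A mesh with phases of class `r` on the modes `S` takes the signal `c` to the signal `c'`. -/
def Reach {N : ℕ} (r : WithTop ℕ∞) (S : Finset (Fin N)) (c c' : ℝ → Fin N → ℂ) : Prop :=
  ∃ T : ℝ → Matrix (Fin N) (Fin N) ℂ, Realizable (ContDiff ℝ r) T ∧ (∀ w, LocalOn S (T w)) ∧
    ∀ w, c' w = T w *ᵥ c w

namespace Reach

variable {N : ℕ} {r : WithTop ℕ∞} {S : Finset (Fin N)} {c c' c'' : ℝ → Fin N → ℂ}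

theorem refl : Reach r S c c := ⟨_, .one, fun _ => .one, by simp⟩

theorem trans (h : Reach r S c c') (h' : Reach r S c' c'') : Reach r S c c'' := by
  obtain ⟨T, hT, hl, hc⟩ := h
  obtain ⟨T', hT', hl', hc'⟩ := h'
  exact ⟨_, hT'.mul hT, fun w => (hl' w).mul (hl w), fun w => by rw [hc', hc, mulVec_mulVec]⟩

theorem contDiff (h : Reach r S c c') (hc : ∀ i, ContDiff ℝ r fun w => c w i) (i : Fin N) :
    ContDiff ℝ r fun w => c' w i := by
  obtain ⟨T, hT, -, hT'⟩ := h
  simp only [hT', mulVec, dotProduct]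
  exact ContDiff.sum fun k _ => (hT.contDiff i k).mul (hc k)

theorem shifter {m : Fin N} (hm : m ∈ S) {φ : ℝ → ℝ} (hφ : ContDiff ℝ r φ) :
    Reach r S c fun w => onMode m (shifterResponse φ w) *ᵥ c w :=
  ⟨_, .shifter m hφ, fun _ => .onMode hm _, fun _ => rfl⟩

theorem reflection {m n : Fin N} (hm : m ∈ S) (hn : n ∈ S) (hmn : m ≠ n) {θ : ℝ → ℝ}
    (hθ : ContDiff ℝ r θ) :
    Reach r S c fun w => twoMode m n (Real.sin (θ w)) (Real.cos (θ w))
      (Real.cos (θ w)) (-Real.sin (θ w)) *ᵥ c w :=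
  ⟨_, .reflection hmn hθ, fun _ => .twoMode hm hn _ _ _ _, fun _ => rfl⟩

/-- A constant generic transformation of two modes makes both signals nonzero at all frequencies
at which the modes are not both empty. -/
theorem exists_mix (hr : 1 ≤ r) (hc : ∀ i, ContDiff ℝ r fun w => c w i) {s j : Fin N}
    (hs : s ∈ S) (hj : j ∈ S) (hsj : s ≠ j) :
    ∃ c', Reach r S c c' ∧
      (∀ w, (c' w s = 0 ∨ c' w j = 0) → c w s = 0 ∧ c w j = 0) ∧
      ∀ w i, i ≠ s → i ≠ j → c' w i = c w i := by
  obtain ⟨t, ht0, ht⟩ := exists_generic_mixture hr (hc s) (hc j)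
  have hp : 0 < ‖t‖ := norm_pos_iff.2 ht0
  -- With phase `arg t` on mode `j` and `tan θ = 1/‖t‖`, the outputs are nonzero constant multiples
  -- of `f + t g` and `conj t f - g`, the two generic mixtures.
  set θ := Real.arctan (1 / ‖t‖)
  have hcos : 0 < Real.cos θ := Real.cos_arctan_pos _
  have hsin : Real.sin θ * ‖t‖ = Real.cos θ := by
    have h : Real.tan θ = 1 / ‖t‖ := Real.tan_arctan _
    rw [Real.tan_eq_sin_div_cos] at h
    field_simp at h
    linarith
  have hcosC : (Real.cos θ : ℂ) ≠ 0 := Complex.ofReal_ne_zero.2 hcos.ne'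
  have hpC : (‖t‖ : ℂ) ≠ 0 := Complex.ofReal_ne_zero.2 hp.ne'
  have hsinC : (Real.sin θ : ℂ) * ‖t‖ = Real.cos θ := by exact_mod_cast hsin
  have hsn : (Real.sin θ : ℂ) ≠ 0 := fun h => hcosC (by rw [← hsinC, h, zero_mul])
  refine ⟨_, (shifter hj (φ := fun _ => t.arg) contDiff_const).trans
    (reflection hs hj hsj (θ := fun _ => θ) contDiff_const), fun w h => ?_, fun w i h1 h2 => ?_⟩
  · simp only [twoMode_mulVec hsj, onMode_mulVec, if_true, if_false, hsj, hsj.symm] at h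
    have he : (‖t‖ : ℂ) * shifterResponse (fun _ => t.arg) w = t := by
      rw [shifterResponse, mul_comm Complex.I, Complex.norm_mul_exp_arg_mul_I]
    have he' : (starRingEnd ℂ) t * t = ‖t‖ * ‖t‖ := by
      rw [mul_comm, Complex.mul_conj, Complex.normSq_eq_norm_sq]
      push_cast
      ring
    have hcj : (starRingEnd ℂ) (‖t‖ : ℂ) = ‖t‖ := Complex.conj_ofReal _
    generalize shifterResponse (fun _ => t.arg) w = y at *
    generalize (‖t‖ : ℂ) = τ at *
    refine ht w (h.imp (fun h => ?_) fun h => ?_)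
    · refine mul_left_cancel₀ hsn ?_
      linear_combination h - Real.sin θ * c w j * he + y * c w j * hsinC
    · refine mul_left_cancel₀ (mul_ne_zero hcosC hpC) ?_
      rw [← he, map_mul, hcj] at he'
      have hy : (starRingEnd ℂ) y * y = 1 := by
        refine mul_left_cancel₀ (mul_ne_zero hpC hpC) ?_
        linear_combination he'
      rw [← he, map_mul, hcj]
      linear_combination (τ * τ * (starRingEnd ℂ) y) * h +
        (τ * τ * c w j * Real.sin θ) * hy + τ * c w j * hsinC
  · simp only [twoMode_mulVec hsj, onMode_mulVec, h1, h2, if_false]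

/-- If two modes carry nowhere vanishing signals then one of them can be emptied into the other. -/
theorem exists_merge (hr : 1 ≤ r) (hc : ∀ i, ContDiff ℝ r fun w => c w i) {s j : Fin N}
    (hs : s ∈ S) (hj : j ∈ S) (hsj : s ≠ j) (hs0 : ∀ w, c w s ≠ 0) (hj0 : ∀ w, c w j ≠ 0) :
    ∃ c', Reach r S c c' ∧ (∀ w, c' w s ≠ 0) ∧ (∀ w, c' w j = 0) ∧
      ∀ w i, i ≠ s → i ≠ j → c' w i = c w i := by
  obtain ⟨φ, hφ, hφs⟩ := exists_contDiff_phase hr (hc s) hs0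
  obtain ⟨ψ, hψ, hψj⟩ := exists_contDiff_phase hr (hc j) hj0
  have hns : ContDiff ℝ r fun w => ‖c w s‖ := (hc s).norm ℝ hs0
  have hnj : ContDiff ℝ r fun w => ‖c w j‖ := (hc j).norm ℝ hj0
  -- Once both phases are removed the inputs are the positive moduli, and this angle makes the
  -- output `cos θ ‖c w s‖ - sin θ ‖c w j‖` vanish.
  set θ : ℝ → ℝ := fun w => Real.arctan (‖c w s‖ / ‖c w j‖) with hθ
  have hθc : ContDiff ℝ r θ := Real.contDiff_arctan.comp
    (hns.div hnj fun w => norm_ne_zero_iff.2 (hj0 w))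
  have hcos : ∀ w, 0 < Real.cos (θ w) := fun w => Real.cos_arctan_pos _
  have hsin : ∀ w, Real.sin (θ w) * ‖c w j‖ = Real.cos (θ w) * ‖c w s‖ := fun w => by
    have h : Real.tan (θ w) = ‖c w s‖ / ‖c w j‖ := Real.tan_arctan _
    rw [Real.tan_eq_sin_div_cos] at h
    have h1 := (hcos w).ne'
    have h2 := norm_ne_zero_iff.2 (hj0 w)
    field_simp at h
    linarith
  have hx : ∀ (χ : ℝ → ℝ) (w : ℝ) (z : ℂ), z = ‖z‖ * shifterResponse χ w →
      shifterResponse (fun x => - χ x) w * z = ‖z‖ := by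
    intro χ w z hz
    conv_lhs => rw [hz]
    linear_combination (‖z‖ : ℂ) * shifterResponse_neg_mul χ w
  refine ⟨_, ((shifter hs hφ.neg).trans (shifter hj hψ.neg)).trans (reflection hs hj hsj hθc),
    fun w => ?_, fun w => ?_, fun w i h1 h2 => ?_⟩
  · simp only [twoMode_mulVec hsj, onMode_mulVec, if_true, if_false, hsj, hsj.symm]
    rw [hx φ w _ (hφs w), hx ψ w _ (hψj w)]
    have h1 := norm_pos_iff.2 (hs0 w)
    have h2 := norm_pos_iff.2 (hj0 w)
    have h3 : 0 < Real.sin (θ w) := pos_of_mul_pos_left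
      ((hsin w).symm ▸ mul_pos (hcos w) h1) h2.le
    have h4 := hcos w
    have : Real.sin (θ w) * ‖c w s‖ + Real.cos (θ w) * ‖c w j‖ ≠ 0 := by positivity
    exact_mod_cast this
  · simp only [twoMode_mulVec hsj, onMode_mulVec, if_true, if_false, hsj, hsj.symm]
    rw [hx φ w _ (hφs w), hx ψ w _ (hψj w)]
    have := hsin w
    have : Real.cos (θ w) * ‖c w s‖ + -Real.sin (θ w) * ‖c w j‖ = 0 := by linarith
    exact_mod_cast this
  · simp only [twoMode_mulVec hsj, onMode_mulVec, h1, h2, if_false]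

/-- Mode `s` is mixed with each `j ∈ J` in turn; a zero left in `s` must have been a zero of `s` and
of all of these. -/
theorem exists_fill (hr : 1 ≤ r) (hc : ∀ i, ContDiff ℝ r fun w => c w i) {s : Fin N}
    (hs : s ∈ S) (J : Finset (Fin N)) (hJ : J ⊆ S) (hsJ : s ∉ J) :
    ∃ c', Reach r S c c' ∧ (∀ w, c' w s = 0 → c w s = 0 ∧ ∀ j ∈ J, c w j = 0) ∧
      ∀ w i, i ≠ s → i ∉ J → c' w i = c w i := by
  induction J using Finset.induction_on with
  | empty => exact ⟨c, refl, by simp, by simp⟩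
  | insert j J hjJ ih =>
    obtain ⟨c', h1, h2, h3⟩ := ih (fun x hx => hJ (Finset.mem_insert_of_mem hx))
      (fun h => hsJ (Finset.mem_insert_of_mem h))
    have hsj : s ≠ j := fun h => hsJ (h ▸ Finset.mem_insert_self _ _)
    obtain ⟨c'', h1', h2', h3'⟩ := exists_mix hr (h1.contDiff hc) hs
      (hJ (Finset.mem_insert_self _ _)) hsj
    refine ⟨c'', h1.trans h1', fun w hw => ?_, fun w i hi hi' => ?_⟩
    · obtain ⟨h4, h5⟩ := h2' w (.inl hw)
      obtain ⟨h6, h7⟩ := h2 w h4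
      refine ⟨h6, fun k hk => ?_⟩
      rcases Finset.mem_insert.1 hk with rfl | hk
      · rw [← h3 w k hsj.symm hjJ, h5]
      · exact h7 k hk
    · simp only [Finset.mem_insert, not_or] at hi'
      rw [h3' w i hi hi'.1, h3 w i hi hi'.2]

/-- Merging needs two nowhere vanishing signals. Since `s` never vanishes, a generic mixing with `j`
first makes `j` nonvanishing too; modes already emptied are not touched. -/
theorem exists_clear (hr : 1 ≤ r) (hc : ∀ i, ContDiff ℝ r fun w => c w i) {s : Fin N}
    (hs : s ∈ S) (hs0 : ∀ w, c w s ≠ 0) (J : Finset (Fin N)) (hJ : J ⊆ S) (hsJ : s ∉ J) :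
    ∃ c', Reach r S c c' ∧ (∀ w, c' w s ≠ 0) ∧ (∀ w, ∀ j ∈ J, c' w j = 0) ∧
      ∀ w i, i ≠ s → i ∉ J → c' w i = c w i := by
  induction J using Finset.induction_on with
  | empty => exact ⟨c, refl, hs0, by simp, by simp⟩
  | insert j J hjJ ih =>
    obtain ⟨c', h1, h2, h3, h4⟩ := ih (fun x hx => hJ (Finset.mem_insert_of_mem hx))
      (fun h => hsJ (Finset.mem_insert_of_mem h))
    have hsj : s ≠ j := fun h => hsJ (h ▸ Finset.mem_insert_self _ _)
    have hjS := hJ (Finset.mem_insert_self _ _)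
    obtain ⟨d, g1, g2, g3⟩ := exists_mix hr (h1.contDiff hc) hs hjS hsj
    obtain ⟨e, k1, k2, k3, k4⟩ := exists_merge hr (g1.contDiff (h1.contDiff hc)) hs hjS hsj
      (fun w h => h2 w (g2 w (.inl h)).1) (fun w h => h2 w (g2 w (.inr h)).1)
    refine ⟨e, (h1.trans g1).trans k1, k2, fun w i hi => ?_, fun w i hi hi' => ?_⟩
    · rcases Finset.mem_insert.1 hi with rfl | hi
      · exact k3 w
      · have his : i ≠ s := fun h => hsJ (h ▸ Finset.mem_insert_of_mem hi)
        have hij : i ≠ j := fun h => hjJ (h ▸ hi)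
        rw [k4 w i his hij, g3 w i his hij, h3 w i hi]
    · simp only [Finset.mem_insert, not_or] at hi'
      rw [k4 w i hi hi'.1, g3 w i hi hi'.1, h4 w i hi hi'.2]

/-- A nowhere vanishing signal on the modes `S` can be collected in one mode. -/
theorem exists_eliminate (hr : 1 ≤ r) (hc : ∀ i, ContDiff ℝ r fun w => c w i) {s : Fin N}
    (hs : s ∈ S) (hcS : ∀ w, ∀ i ∉ S, c w i = 0) (hc0 : ∀ w, c w ≠ 0) :
    ∃ c', Reach r S c c' ∧ ∀ w, ∃ ρ : ℝ, 0 < ρ ∧ c' w = Pi.single s (ρ : ℂ) := by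
  obtain ⟨d, h1, h2, h3⟩ := exists_fill hr hc hs (S.erase s) (Finset.erase_subset _ _)
    (Finset.notMem_erase _ _)
  obtain ⟨e, k1, k2, k3, k4⟩ := exists_clear hr (h1.contDiff hc) hs
    (fun w h => hc0 w <| by
      obtain ⟨a, b⟩ := h2 w h
      funext i
      by_cases his : i = s
      · exact his ▸ a
      · by_cases hiS : i ∈ S
        · exact b i (Finset.mem_erase.2 ⟨his, hiS⟩)
        · exact hcS w i hiS) (S.erase s) (Finset.erase_subset _ _) (Finset.notMem_erase _ _)
  -- A last phase shifter makes the surviving entry positive.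
  obtain ⟨φ, hφ, hφs⟩ := exists_contDiff_phase hr (k1.contDiff (h1.contDiff hc) s) k2
  refine ⟨_, (h1.trans k1).trans (shifter hs hφ.neg), fun w => ⟨‖e w s‖, norm_pos_iff.2 (k2 w), ?_⟩⟩
  funext i
  rw [onMode_mulVec]
  by_cases his : i = s
  · subst his
    rw [if_pos rfl, Pi.single_eq_same]
    conv_lhs => rw [hφs w]
    linear_combination (‖e w i‖ : ℂ) * shifterResponse_neg_mul φ w
  · rw [if_neg his, Pi.single_eq_of_ne his]
    by_cases hiS : i ∈ S
    · exact k3 w i (Finset.mem_erase.2 ⟨his, hiS⟩)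
    · have hi' : i ∉ S.erase s := fun h => hiS (Finset.mem_of_mem_erase h)
      rw [k4 w i his hi', h3 w i his hi', hcS w i hiS]

end Reach

/-- Induction on the set of active modes. A mesh `T` takes column `s` of `U` to a positive multiple
of the basis vector, so `T U` acts on the remaining modes only, and `U = Tᴴ (T U)`. -/
theorem realizable_of_localOn {N : ℕ} {r : WithTop ℕ∞} (hr : 1 ≤ r) (S : Finset (Fin N)) :
    ∀ {U : ℝ → Matrix (Fin N) (Fin N) ℂ}, (∀ i j, ContDiff ℝ r fun w => U w i j) →
      (∀ w, U w ∈ unitaryGroup (Fin N) ℂ) → (∀ w, LocalOn S (U w)) →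
      Realizable (ContDiff ℝ r) U := by
  induction S using Finset.induction_on with
  | empty =>
    intro U _ _ hl
    convert! Realizable.one using 2 with w
    ext i j
    exact hl w i j (by simp)
  | insert s S hsS ih =>
    intro U hU hu hl
    have hs := Finset.mem_insert_self s S
    obtain ⟨c', ⟨T, hT, hTl, hTc⟩, hc'⟩ := Reach.exists_eliminate hr (c := fun w i => U w i s)
      (fun i => hU i s) hs (fun w i hi => by
        rw [hl w i s (.inl hi), one_apply_ne]
        rintro rfl
        exact hi hs) (fun w h => by
        have h1 : ((U w)ᴴ * U w) s s = 1 := by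
          have := mem_unitaryGroup_iff'.1 (hu w)
          rw [star_eq_conjTranspose] at this
          rw [this, one_apply_eq]
        rw [Matrix.mul_apply] at h1
        have h2 : ∀ i, U w i s = 0 := fun i => congrFun h i
        simp [h2] at h1)
    set V : ℝ → Matrix (Fin N) (Fin N) ℂ := fun w => T w * U w with hV
    have hVu : ∀ w, V w ∈ unitaryGroup (Fin N) ℂ := fun w => mul_mem (hT.mem_unitaryGroup w) (hu w)
    have hVl : ∀ w, LocalOn (insert s S) (V w) := fun w => (hTl w).mul (hl w)
    have hcol : ∀ w, ∃ ρ : ℝ, 0 < ρ ∧ ∀ i, V w i s = if i = s then (ρ : ℂ) else 0 := fun w => by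
      obtain ⟨ρ, h0, h⟩ := hc' w
      refine ⟨ρ, h0, fun i => ?_⟩
      rw [hTc] at h
      have := congrFun h i
      rw [Pi.single_apply] at this
      exact this
    -- Columns of a unitary have norm one, so `ρ = 1`.
    have hcol1 : ∀ w i, V w i s = if i = s then 1 else 0 := fun w i => by
      obtain ⟨ρ, h0, h⟩ := hcol w
      have h1 : ((V w)ᴴ * V w) s s = 1 := by
        have := mem_unitaryGroup_iff'.1 (hVu w)
        rw [star_eq_conjTranspose] at this
        rw [this, one_apply_eq]
      rw [Matrix.mul_apply] at h1
      simp only [conjTranspose_apply, h] at h1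
      simp at h1
      have h2 : ρ * ρ = 1 := by exact_mod_cast h1
      have h3 : ρ = 1 := by nlinarith
      rw [h, h3, Complex.ofReal_one]
    -- Orthogonality of column `i` to column `s`, now a basis vector.
    have hrow : ∀ w i, i ≠ s → V w s i = 0 := fun w i hi => by
      have h1 : (V w)ᴴ * V w = 1 := mem_unitaryGroup_iff'.1 (hVu w)
      have h2 := congrFun (congrFun h1 s) i
      rw [Matrix.mul_apply, one_apply_ne hi.symm] at h2
      simpa [conjTranspose_apply, hcol1] using h2
    have hVr : Realizable (ContDiff ℝ r) V := by
      refine ih (fun i j => ?_) hVu fun w i j hij => ?_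
      · simp only [hV, Matrix.mul_apply]
        exact ContDiff.sum fun k _ => (hT.contDiff i k).mul (hU k j)
      · by_cases hj : j = s
        · subst hj
          rw [hcol1, one_apply]
        · by_cases hi : i = s
          · subst hi
            rw [hrow w j hj, one_apply_ne (Ne.symm hj)]
          · refine hVl w i j (hij.imp ?_ ?_) <;> simp_all
    convert! (hT.star fun φ hφ => hφ.neg).mul hVr using 2 with w
    have h1 : (T w)ᴴ * T w = 1 := mem_unitaryGroup_iff'.1 (hT.mem_unitaryGroup w)
    rw [hV, ← mul_assoc, h1, one_mul]

/-- Every smooth, or real-analytic, unitary function of the frequency is the transfer function of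
a mesh of beamsplitters and phase shifters. -/
theorem realizable_of_contDiff {N : ℕ} {r : WithTop ℕ∞} (hr : 1 ≤ r)
    {U : ℝ → Matrix (Fin N) (Fin N) ℂ} (hU : ∀ i j, ContDiff ℝ r fun w => U w i j)
    (hu : ∀ w, U w ∈ unitaryGroup (Fin N) ℂ) : Realizable (ContDiff ℝ r) U :=
  realizable_of_localOn hr Finset.univ hU hu fun w i j h => by simp at h

/-- A constant unitary needs constant phases only. -/
theorem realizable_const {N : ℕ} {A : Matrix (Fin N) (Fin N) ℂ}
    (hA : A ∈ unitaryGroup (Fin N) ℂ) :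
    Realizable (fun φ => ∃ θ : ℝ, φ = fun _ => θ) fun _ => A := by
  obtain ⟨M, -, hM⟩ := realizable_of_contDiff (r := 1) le_rfl (U := fun _ => A)
    (fun _ _ => contDiff_const) fun _ => hA
  -- Freezing every phase at its value at frequency 0 does not change the transfer matrix there.
  suffices H : ∀ M : Mesh N (ℝ → ℝ), Realizable (fun φ => ∃ θ : ℝ, φ = fun _ => θ)
      fun _ => M.transfer shifterResponse 0 by
    simpa only [hM] using H M
  clear hM M
  intro M
  induction M with
  | nil => simpa [Mesh.transfer] using Realizable.one
  | cons e M ih =>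
    simp only [Mesh.transfer_cons]
    refine Realizable.mul ?_ ih
    cases e with
    | splitter m n hmn => exact .beamSplitter hmn
    | single m φ => exact Realizable.shifter m (φ := fun _ => φ 0) ⟨_, rfl⟩

/-- Every vector can be rotated by a unitary into a multiple of a given basis vector. -/
theorem exists_unitary_mulVec_eq_single {N : ℕ} (s : Fin N) {v : Fin N → ℂ} (hv : v ≠ 0) :
    ∃ A ∈ unitaryGroup (Fin N) ℂ, ∃ ρ : ℝ, 0 < ρ ∧ A *ᵥ v = Pi.single s (ρ : ℂ) := by
  obtain ⟨c', ⟨T, hT, -, hTc⟩, hc'⟩ := Reach.exists_eliminate (r := 1) le_rfl (c := fun _ => v)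
    (fun _ => contDiff_const) (Finset.mem_univ s) (by simp) (fun _ => hv)
  obtain ⟨ρ, h0, h⟩ := hc' 0
  exact ⟨T 0, hT.mem_unitaryGroup 0, ρ, h0, by rw [← hTc, h]⟩

/-! ### Phases approximated by cavity chains alone -/

theorem Cavity.denominator_ne_zero (c : Cavity) (w : ℝ) :
    (c.γ : ℂ) - Complex.I * ((w : ℂ) + (c.Δ : ℂ)) ≠ 0 := fun h => by
  have := congrArg Complex.re h
  simp at this
  exact c.γ_pos.ne' this

/-- The numerator is the conjugate of the denominator, so the phase is twice the argument of `γ +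
i(w + Δ)`, an arctangent since `γ > 0`. -/
theorem Cavity.response_eq_shifterResponse (c : Cavity) (w : ℝ) :
    c.response w = shifterResponse (fun w => 2 * Real.arctan ((w + c.Δ) / c.γ)) w := by
  set x : ℝ := (w + c.Δ) / c.γ with hx
  have hcos : (Real.cos (Real.arctan x) : ℂ) ≠ 0 :=
    Complex.ofReal_ne_zero.2 (Real.cos_arctan_pos x).ne'
  have hsin : (Real.sin (Real.arctan x) : ℂ) * c.γ =
      Real.cos (Real.arctan x) * ((w : ℂ) + (c.Δ : ℂ)) := by
    have h : Real.tan (Real.arctan x) = x := Real.tan_arctan x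
    have h0 := (Real.cos_arctan_pos x).ne'
    have h1 := c.γ_pos.ne'
    rw [Real.tan_eq_sin_div_cos, div_eq_iff h0] at h
    rw [h, hx]
    push_cast
    field_simp [Complex.ofReal_ne_zero.2 h1]
  have hy : Complex.exp (Real.arctan x * Complex.I) =
      Real.cos (Real.arctan x) + Real.sin (Real.arctan x) * Complex.I := by
    rw [Complex.exp_mul_I, Complex.ofReal_cos, Complex.ofReal_sin]
  have hsq : (Real.sin (Real.arctan x) : ℂ) ^ 2 + (Real.cos (Real.arctan x) : ℂ) ^ 2 = 1 := by
    exact_mod_cast Real.sin_sq_add_cos_sq (Real.arctan x)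
  have hz : shifterResponse (fun w => 2 * Real.arctan ((w + c.Δ) / c.γ)) w =
      Complex.exp (Real.arctan x * Complex.I) * Complex.exp (Real.arctan x * Complex.I) := by
    rw [shifterResponse, ← Complex.exp_add, hx]
    push_cast
    ring_nf
  rw [Cavity.response, hz, hy, div_eq_iff (c.denominator_ne_zero w)]
  have hI := Complex.I_sq
  generalize (Real.cos (Real.arctan x) : ℂ) = p at *
  generalize (Real.sin (Real.arctan x) : ℂ) = q at *
  generalize (w : ℂ) + (c.Δ : ℂ) = v at *
  generalize (c.γ : ℂ) = g at *
  have hq : p * (g + Complex.I * v) = g * (p + q * Complex.I) := by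
    linear_combination -Complex.I * hsin
  have hq' : p * (g - Complex.I * v) = g * (p - q * Complex.I) := by
    linear_combination Complex.I * hsin
  refine mul_left_cancel₀ hcos ?_
  linear_combination hq - (p + q * Complex.I) ^ 2 * hq' - g * (p + q * Complex.I) * hsq +
    g * (p + q * Complex.I) * q ^ 2 * hI

theorem norm_chainResponse (C : List Cavity) (w : ℝ) : ‖chainResponse C w‖ = 1 := by
  induction C with
  | nil => simp [chainResponse]
  | cons c C ih =>
    simp only [chainResponse, List.map_cons, List.prod_cons, norm_mul] at ih ⊢
    rw [ih, c.response_eq_shifterResponse, norm_shifterResponse, one_mul]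

theorem chainResponse_append (C D : List Cavity) (w : ℝ) :
    chainResponse (C ++ D) w = chainResponse C w * chainResponse D w := by
  simp [chainResponse]

theorem norm_shifterResponse_sub_le (φ ψ : ℝ → ℝ) (w : ℝ) :
    ‖shifterResponse φ w - shifterResponse ψ w‖ ≤ |φ w - ψ w| := by
  have h : shifterResponse φ w - shifterResponse ψ w =
      shifterResponse ψ w * (Complex.exp (Complex.I * (φ w - ψ w : ℝ)) - 1) := by
    rw [mul_sub, mul_one, shifterResponse, shifterResponse, ← Complex.exp_add]
    push_cast
    ring_nf
  rw [h, norm_mul, norm_shifterResponse, one_mul]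
  exact Real.norm_exp_I_mul_ofReal_sub_one_le

theorem norm_mul_sub_mul_lt {x y u v : ℂ} {ε : ℝ} (hx : ‖x‖ = 1) (hv : ‖v‖ = 1)
    (h1 : ‖x - u‖ < ε / 2) (h2 : ‖y - v‖ < ε / 2) : ‖x * y - u * v‖ < ε := by
  calc ‖x * y - u * v‖ = ‖x * (y - v) + (x - u) * v‖ := by ring_nf
    _ ≤ ‖x * (y - v)‖ + ‖(x - u) * v‖ := norm_add_le _ _
    _ < ε := by rw [norm_mul, norm_mul, hx, hv]; linarith

/-- On `K` the phase shifter with phase `φ` is approximated by cavity chains. -/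
def ChainApprox (K : Set ℝ) (φ : ℝ → ℝ) : Prop :=
  ∀ ε : ℝ, 0 < ε → ∃ C : List Cavity, ∀ w ∈ K, ‖chainResponse C w - shifterResponse φ w‖ < ε

namespace ChainApprox

variable {K : Set ℝ} {φ ψ : ℝ → ℝ}

theorem add (hφ : ChainApprox K φ) (hψ : ChainApprox K ψ) :
    ChainApprox K fun w => φ w + ψ w := by
  intro ε hε
  obtain ⟨C, hC⟩ := hφ (ε / 2) (half_pos hε)
  obtain ⟨D, hD⟩ := hψ (ε / 2) (half_pos hε)
  refine ⟨C ++ D, fun w hw => ?_⟩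
  rw [chainResponse_append, shifterResponse_add]
  exact norm_mul_sub_mul_lt (norm_chainResponse _ _) (norm_shifterResponse _ _) (hC w hw) (hD w hw)

theorem zero : ChainApprox K fun _ => 0 := fun ε hε =>
  ⟨[], fun w _ => by simpa [chainResponse, shifterResponse] using hε⟩

theorem nat_mul (hφ : ChainApprox K φ) (n : ℕ) : ChainApprox K fun w => n * φ w := by
  induction n with
  | zero => simpa using zero
  | succ n ih => simpa only [Nat.cast_succ, add_mul, one_mul] using ih.add hφ

theorem of_limit (h : ∀ ε : ℝ, 0 < ε → ∃ ψ, ChainApprox K ψ ∧ ∀ w ∈ K, |ψ w - φ w| ≤ ε) :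
    ChainApprox K φ := by
  intro ε hε
  obtain ⟨ψ, hψ, hψφ⟩ := h (ε / 2) (half_pos hε)
  obtain ⟨C, hC⟩ := hψ (ε / 2) (half_pos hε)
  refine ⟨C, fun w hw => ?_⟩
  have h1 := norm_sub_le_norm_sub_add_norm_sub (chainResponse C w) (shifterResponse ψ w)
    (shifterResponse φ w)
  have h2 := norm_shifterResponse_sub_le ψ φ w
  linarith [hC w hw, hψφ w hw]

theorem cavity (c : Cavity) : ChainApprox K fun w => 2 * Real.arctan ((w + c.Δ) / c.γ) :=
  fun ε hε => ⟨[c], fun w _ => by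
    simpa [chainResponse, c.response_eq_shifterResponse] using hε⟩

/-- Since `γ > 0`, single cavities give only positive slopes `t`. -/
theorem arctan_of_pos {t : ℝ} (ht : 0 < t) (δ : ℝ) :
    ChainApprox K fun w => 2 * Real.arctan (t * w + δ) := by
  convert! cavity ⟨1 / t, one_div_pos.2 ht, δ / t⟩ using 4 with w
  field_simp

theorem _root_.Real.abs_arctan_sub_arctan_le (x y : ℝ) :
    |Real.arctan x - Real.arctan y| ≤ |x - y| := by
  have := Convex.norm_image_sub_le_of_norm_deriv_le (f := Real.arctan) (C := 1) (s := Set.univ)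
    (x := y) (y := x) (fun z _ => Real.differentiable_arctan z) (fun z _ => by
      rw [Real.deriv_arctan, Real.norm_eq_abs, abs_of_pos (by positivity), div_le_one (by positivity)]
      nlinarith [sq_nonneg z]) convex_univ (Set.mem_univ _) (Set.mem_univ _)
  simpa using this

/-- A very broad cavity has nearly constant phase `2 arctan δ` on a bounded set; sums of equal such
phases reach every angle. -/
theorem const {B : ℝ} (hK : ∀ w ∈ K, |w| ≤ B) (θ : ℝ) : ChainApprox K fun _ => θ := by
  have harc : ∀ δ : ℝ, ChainApprox K fun _ => 2 * Real.arctan δ := fun δ => by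
    refine of_limit fun ε hε => ?_
    have hB : 0 < |B| + 1 := by positivity
    -- As `arctan` is 1-Lipschitz the error is at most `2 t |w| ≤ ε`; the `+ 1` only guards against
    -- `B = 0`.
    refine ⟨_, arctan_of_pos (t := ε / 2 / (|B| + 1)) (by positivity) δ, fun w hw => ?_⟩
    have h1 := Real.abs_arctan_sub_arctan_le (ε / 2 / (|B| + 1) * w + δ) δ
    rw [add_sub_cancel_right, abs_mul, abs_of_pos (by positivity : 0 < ε / 2 / (|B| + 1))] at h1
    have h2 : ε / 2 / (|B| + 1) * |w| ≤ ε / 2 := by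
      rw [div_mul_eq_mul_div, div_le_iff₀ hB]
      have := hK w hw
      have := le_abs_self B
      gcongr
      linarith
    rw [← mul_sub, abs_mul, abs_two]
    linarith
  -- This puts `θ / (2n)` in `(-π/2, π/2)`, where `arctan` inverts `tan`.
  obtain ⟨n, hn⟩ := exists_nat_gt (|θ| / Real.pi)
  have hn0 : (0 : ℝ) < n := lt_of_le_of_lt (by positivity) hn
  have hlt : |θ / n| < Real.pi := by
    rw [abs_div, Nat.abs_cast, div_lt_iff₀ hn0]
    rw [div_lt_iff₀ Real.pi_pos] at hn
    linarith
  rw [abs_lt] at hlt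
  convert! (harc (Real.tan (θ / n / 2))).nat_mul n using 2
  rw [Real.arctan_tan (by linarith) (by linarith)]
  field_simp

end ChainApprox

/-! ### Phases approximated up to a reference chain -/

/-- On `K` the phase shifter with phase `φ` is approximated by cavity chains up to the response
of a reference chain. -/
def RelApprox (K : Set ℝ) (φ : ℝ → ℝ) : Prop :=
  ∀ ε : ℝ, 0 < ε → ∃ C D : List Cavity, ∀ w ∈ K,
    ‖chainResponse C w - chainResponse D w * shifterResponse φ w‖ < ε

theorem ChainApprox.relApprox {K : Set ℝ} {φ : ℝ → ℝ} (h : ChainApprox K φ) : RelApprox K φ := by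
  intro ε hε
  obtain ⟨C, hC⟩ := h ε hε
  exact ⟨C, [], fun w hw => by simpa [chainResponse] using hC w hw⟩

namespace RelApprox

variable {K : Set ℝ} {φ ψ : ℝ → ℝ}

theorem add (hφ : RelApprox K φ) (hψ : RelApprox K ψ) : RelApprox K fun w => φ w + ψ w := by
  intro ε hε
  obtain ⟨C, D, hC⟩ := hφ (ε / 2) (half_pos hε)
  obtain ⟨C', D', hC'⟩ := hψ (ε / 2) (half_pos hε)
  refine ⟨C ++ C', D ++ D', fun w hw => ?_⟩
  rw [chainResponse_append, chainResponse_append, shifterResponse_add, mul_mul_mul_comm]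
  refine norm_mul_sub_mul_lt (norm_chainResponse _ _) ?_ (hC w hw) (hC' w hw)
  rw [norm_mul, norm_chainResponse, norm_shifterResponse, one_mul]

/-- The chain and its reference exchange roles. -/
theorem neg (hφ : RelApprox K φ) : RelApprox K fun w => - φ w := by
  intro ε hε
  obtain ⟨C, D, hC⟩ := hφ ε hε
  refine ⟨D, C, fun w hw => ?_⟩
  have h : chainResponse D w - chainResponse C w * shifterResponse (fun w => - φ w) w =
      -((chainResponse C w - chainResponse D w * shifterResponse φ w) *
        shifterResponse (fun w => - φ w) w) := by
    linear_combination -(chainResponse D w) * shifterResponse_neg_mul φ w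
  rw [h, norm_neg, norm_mul, norm_shifterResponse, mul_one]
  exact hC w hw

theorem nat_mul (hφ : RelApprox K φ) (n : ℕ) : RelApprox K fun w => n * φ w := by
  induction n with
  | zero => simpa using ChainApprox.zero.relApprox
  | succ n ih => simpa only [Nat.cast_succ, add_mul, one_mul] using ih.add hφ

theorem of_limit (h : ∀ ε : ℝ, 0 < ε → ∃ ψ, RelApprox K ψ ∧ ∀ w ∈ K, |ψ w - φ w| ≤ ε) :
    RelApprox K φ := by
  intro ε hε
  obtain ⟨ψ, hψ, hψφ⟩ := h (ε / 2) (half_pos hε)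
  obtain ⟨C, D, hC⟩ := hψ (ε / 2) (half_pos hε)
  refine ⟨C, D, fun w hw => ?_⟩
  have h1 := norm_sub_le_norm_sub_add_norm_sub (chainResponse C w)
    (chainResponse D w * shifterResponse ψ w) (chainResponse D w * shifterResponse φ w)
  have h2 := norm_shifterResponse_sub_le ψ φ w
  rw [← mul_sub (chainResponse D w), norm_mul, norm_chainResponse, one_mul] at h1
  linarith [hC w hw, hψφ w hw]

theorem arctan {B : ℝ} (hK : ∀ w ∈ K, |w| ≤ B) (t δ : ℝ) :
    RelApprox K fun w => 2 * Real.arctan (t * w + δ) := by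
  rcases lt_trichotomy t 0 with ht | rfl | ht
  · convert! (ChainApprox.arctan_of_pos (neg_pos.2 ht) (-δ)).relApprox.neg using 2 with w
    rw [← mul_neg, ← Real.arctan_neg]
    ring_nf
  · simpa using (ChainApprox.const hK (2 * Real.arctan δ)).relApprox
  · exact (ChainApprox.arctan_of_pos ht δ).relApprox

end RelApprox

theorem _root_.Real.abs_one_div_one_add_sq_sub_le (x y : ℝ) :
    |1 / (1 + x ^ 2) - 1 / (1 + y ^ 2)| ≤ |x - y| := by
  have hx : 0 < 1 + x ^ 2 := by positivity
  have hy : 0 < 1 + y ^ 2 := by positivity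
  have h : 1 / (1 + x ^ 2) - 1 / (1 + y ^ 2) =
      (y - x) * ((x + y) / ((1 + x ^ 2) * (1 + y ^ 2))) := by
    field_simp
    ring
  rw [h, abs_mul, abs_sub_comm y x]
  refine mul_le_of_le_one_right (abs_nonneg _) ?_
  rw [abs_div, abs_of_pos (mul_pos hx hy), div_le_one (mul_pos hx hy), abs_le]
  constructor <;> nlinarith [sq_nonneg (x + 1), sq_nonneg (y + 1), sq_nonneg (x - 1),
    sq_nonneg (y - 1), sq_nonneg (x * y)]

/-- Mean value inequality for the remainder, using that `1/(1 + x²)` is 1-Lipschitz. The bound is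
uniform in `x`, which makes the difference quotients below converge uniformly. -/
theorem _root_.Real.abs_arctan_add_sub_le (x h : ℝ) :
    |Real.arctan (x + h) - Real.arctan x - h / (1 + x ^ 2)| ≤ h ^ 2 := by
  have hd : ∀ k : ℝ, HasDerivAt (fun k => Real.arctan (x + k) - k / (1 + x ^ 2))
      (1 / (1 + (x + k) ^ 2) - 1 / (1 + x ^ 2)) k := fun k => by
    have h1 := (Real.hasDerivAt_arctan (x + k)).comp k ((hasDerivAt_id k).const_add x)
    have h2 := (hasDerivAt_id k).div_const (1 + x ^ 2)
    rw [mul_one] at h1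
    exact h1.sub h2
  have := Convex.norm_image_sub_le_of_norm_hasDerivWithin_le (C := |h|) (s := Set.uIcc 0 h)
    (x := 0) (y := h) (fun k _ => (hd k).hasDerivWithinAt) (fun k hk => by
      refine (Real.abs_one_div_one_add_sq_sub_le (x + k) x).trans ?_
      rw [add_sub_cancel_left]
      simpa using Set.abs_sub_left_of_mem_uIcc hk) (convex_uIcc 0 h) Set.left_mem_uIcc
      Set.right_mem_uIcc
  simp only [Real.norm_eq_abs, add_zero, zero_div, sub_zero] at this
  rw [sub_right_comm, ← sq_abs h, sq |h|]
  exact this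

/-! ### From cavity phases to polynomials -/

/-- All real multiples of the phase `φ` are approximated by pairs of cavity chains. -/
def LineApprox (K : Set ℝ) (φ : ℝ → ℝ) : Prop :=
  ∀ s : ℝ, RelApprox K fun w => s * φ w

namespace LineApprox

variable {K : Set ℝ} {φ ψ : ℝ → ℝ}

theorem add (hφ : LineApprox K φ) (hψ : LineApprox K ψ) : LineApprox K fun w => φ w + ψ w :=
  fun s => by simpa only [mul_add] using (hφ s).add (hψ s)

theorem const_mul (hφ : LineApprox K φ) (a : ℝ) : LineApprox K fun w => a * φ w :=
  fun s => by simpa only [mul_assoc] using hφ (s * a)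

theorem zero : LineApprox K fun _ => 0 :=
  fun s => by simpa using ChainApprox.zero.relApprox

theorem sum {ι : Type*} (I : Finset ι) {f : ι → ℝ → ℝ} (h : ∀ i ∈ I, LineApprox K (f i)) :
    LineApprox K fun w => ∑ i ∈ I, f i w := by
  classical
  induction I using Finset.induction_on with
  | empty => simpa using zero
  | insert i I hi ih =>
    simp only [Finset.sum_insert hi]
    exact (h i (Finset.mem_insert_self _ _)).add
      (ih fun j hj => h j (Finset.mem_insert_of_mem hj))

theorem of_limit (h : ∀ ε : ℝ, 0 < ε → ∃ ψ, LineApprox K ψ ∧ ∀ w ∈ K, |ψ w - φ w| ≤ ε) :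
    LineApprox K φ := by
  intro s
  refine RelApprox.of_limit fun ε hε => ?_
  have hs : 0 < |s| + 1 := by positivity
  obtain ⟨ψ, hψ, hψφ⟩ := h (ε / (|s| + 1)) (by positivity)
  refine ⟨_, hψ s, fun w hw => ?_⟩
  rw [← mul_sub, abs_mul]
  calc |s| * |ψ w - φ w| ≤ (|s| + 1) * (ε / (|s| + 1)) := by
        gcongr
        · linarith
        · exact hψφ w hw
    _ = ε := by field_simp

/-- The derivative of a family of cavity phases in the direction `u`. -/
theorem of_arctan {B : ℝ} {x u : ℝ → ℝ} (hu : ∀ w ∈ K, |u w| ≤ B)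
    (h : ∀ η : ℝ, RelApprox K fun w => 2 * Real.arctan (x w + η * u w)) :
    LineApprox K fun w => u w / (1 + x w ^ 2) := by
  intro s
  refine RelApprox.of_limit fun ε hε => ?_
  -- Take `n` copies of a difference of phases with step `η = s/(2n)`; by the remainder bound the
  -- error is at most `s² u² / (2n)`.
  obtain ⟨n, hn⟩ := exists_nat_gt (s ^ 2 * B ^ 2 / (2 * ε))
  have hn0 : (0 : ℝ) < n := lt_of_le_of_lt (by positivity) hn
  refine ⟨_, ((h (s / (2 * n))).add (h 0).neg).nat_mul n, fun w hw => ?_⟩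
  have h1 := Real.abs_arctan_add_sub_le (x w) (s / (2 * n) * u w)
  have h2 : (n : ℝ) * (2 * Real.arctan (x w + s / (2 * n) * u w) +
      -(2 * Real.arctan (x w + 0 * u w))) - s * (u w / (1 + x w ^ 2)) =
      2 * n * (Real.arctan (x w + s / (2 * n) * u w) - Real.arctan (x w) -
        s / (2 * n) * u w / (1 + x w ^ 2)) := by
    have : 1 + x w ^ 2 ≠ 0 := by positivity
    rw [zero_mul, add_zero]
    field_simp
    ring
  rw [h2, abs_mul, abs_of_pos (by positivity : (0 : ℝ) < 2 * n)]
  have h3 : u w ^ 2 ≤ B ^ 2 := sq_le_sq' (by linarith [neg_abs_le (u w), hu w hw])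
    (by linarith [le_abs_self (u w), hu w hw])
  rw [div_lt_iff₀ (by positivity)] at hn
  calc _ ≤ 2 * n * (s / (2 * n) * u w) ^ 2 := by gcongr
    _ = s ^ 2 * u w ^ 2 / (2 * n) := by field_simp
    _ ≤ ε := by
      rw [div_le_iff₀ (by positivity)]
      nlinarith [mul_le_mul_of_nonneg_left h3 (sq_nonneg s)]

/-- Letting `τ → 0` removes the denominator, uniformly on bounded sets. The degree rises by `e
w^(2n+2) / (1 + τ w²) = τ⁻¹ (e w^(2n) - e w^(2n) / (1 + τ w²))`. -/
theorem mul_pow_of_resolvent {B : ℝ} (hK : ∀ w ∈ K, |w| ≤ B) {e : ℝ → ℝ} {E : ℝ}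
    (he : ∀ w ∈ K, |e w| ≤ E) (h : ∀ τ : ℝ, 0 < τ → LineApprox K fun w => e w / (1 + τ * w ^ 2))
    (n : ℕ) : LineApprox K fun w => e w * (w ^ 2) ^ n := by
  have key : ∀ n : ℕ, (∀ τ : ℝ, 0 < τ →
      LineApprox K fun w => e w * (w ^ 2) ^ n / (1 + τ * w ^ 2)) →
      LineApprox K fun w => e w * (w ^ 2) ^ n := fun n hn => by
    refine of_limit fun ε hε => ?_
    have hC : 0 < |E| * (B ^ 2) ^ (n + 1) + 1 := by positivity
    refine ⟨_, hn (ε / (|E| * (B ^ 2) ^ (n + 1) + 1)) (by positivity), fun w hw => ?_⟩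
    set τ := ε / (|E| * (B ^ 2) ^ (n + 1) + 1) with hτ
    have hτ0 : 0 < τ := by positivity
    have hpos : 0 < 1 + τ * w ^ 2 := by positivity
    have h1 : e w * (w ^ 2) ^ n / (1 + τ * w ^ 2) - e w * (w ^ 2) ^ n =
        -(τ * (e w * (w ^ 2) ^ (n + 1)) / (1 + τ * w ^ 2)) := by
      field_simp
      ring
    have hwB : w ^ 2 ≤ B ^ 2 := sq_le_sq' (by linarith [neg_abs_le w, hK w hw])
      (by linarith [le_abs_self w, hK w hw])
    have h2 : |e w * (w ^ 2) ^ (n + 1)| ≤ |E| * (B ^ 2) ^ (n + 1) := by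
      rw [abs_mul, abs_of_nonneg (by positivity : 0 ≤ (w ^ 2) ^ (n + 1))]
      have := (he w hw).trans (le_abs_self E)
      gcongr
    rw [h1, abs_neg, abs_div, abs_of_pos hpos, abs_mul, abs_of_pos hτ0]
    calc τ * |e w * (w ^ 2) ^ (n + 1)| / (1 + τ * w ^ 2)
        ≤ τ * |e w * (w ^ 2) ^ (n + 1)| :=
          div_le_self (by positivity) (by linarith [mul_nonneg hτ0.le (sq_nonneg w)])
      _ ≤ τ * (|E| * (B ^ 2) ^ (n + 1) + 1) := by
          gcongr
          linarith
      _ = ε := by rw [hτ]; field_simp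
  refine key n ?_
  induction n with
  | zero => simpa using h
  | succ n ih =>
    intro τ hτ
    convert! ((key n ih).add ((ih τ hτ).const_mul (-1))).const_mul τ⁻¹ using 2 with w
    have : 0 < 1 + τ * w ^ 2 := by positivity
    field_simp
    ring

/-- Differentiating `2 arctan(√τ w + δ)` in the offset gives the even seed `1/(1 + τ w²)`;
differentiating in the slope gives the odd seed `w/(1 + τ w²)`. -/
theorem pow {B : ℝ} (hK : ∀ w ∈ K, |w| ≤ B) (n : ℕ) : LineApprox K fun w => w ^ n := by
  have h1 : ∀ τ : ℝ, 0 < τ → LineApprox K fun w => 1 / (1 + τ * w ^ 2) := fun τ hτ => by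
    have := of_arctan (K := K) (B := 1) (x := fun w => Real.sqrt τ * w) (u := fun _ => 1)
      (by simp) fun η => by simpa using RelApprox.arctan hK (Real.sqrt τ) η
    simpa only [mul_pow, Real.sq_sqrt hτ.le] using this
  have h2 : ∀ τ : ℝ, 0 < τ → LineApprox K fun w => w / (1 + τ * w ^ 2) := fun τ hτ => by
    have := of_arctan (K := K) (B := B) (x := fun w => Real.sqrt τ * w) (u := fun w => w)
      hK fun η => by simpa [add_mul] using RelApprox.arctan hK (Real.sqrt τ + η) 0
    simpa only [mul_pow, Real.sq_sqrt hτ.le] using this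
  obtain ⟨k, rfl | rfl⟩ := n.even_or_odd'
  · simpa [pow_mul] using mul_pow_of_resolvent hK (e := fun _ => 1) (E := 1) (by simp) h1 k
  · have := mul_pow_of_resolvent hK (e := fun w => w) (E := B) hK h2 k
    convert! this using 2 with w
    rw [pow_succ, pow_mul, mul_comm]

end LineApprox

/-- On every band a continuous phase is approximated by cavity chains, up to the response of a
reference chain. -/
theorem relApprox_of_continuous {φ : ℝ → ℝ} (hφ : Continuous φ) (a b : ℝ) :
    RelApprox (Set.Icc a b) φ := by
  have hK : ∀ w ∈ Set.Icc a b, |w| ≤ max |a| |b| := fun w hw => abs_le_max_abs_abs hw.1 hw.2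
  have : LineApprox (Set.Icc a b) φ := by
    refine LineApprox.of_limit fun ε hε => ?_
    obtain ⟨p, hp⟩ := exists_polynomial_near_of_continuousOn a b φ hφ.continuousOn ε hε
    refine ⟨fun w => p.eval w, ?_, fun w hw => (hp w hw).le⟩
    simp only [Polynomial.eval_eq_sum_range]
    exact LineApprox.sum _ fun i _ => (LineApprox.pow hK i).const_mul _
  simpa using this 1

/-! ### Propagation of errors through a mesh -/

/-- An entry of the product is a sum of `N` terms, each in error by at most `ε/(N + 1)`; using `N +
1` keeps the bound strict and covers `N = 0`. -/
theorem norm_mul_apply_sub_lt {N : ℕ} {A B A₀ B₀ : Matrix (Fin N) (Fin N) ℂ} {ε : ℝ} (hε : 0 < ε)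
    (hA : ∀ i j, ‖A i j - A₀ i j‖ < ε / (2 * (N + 1)))
    (hB : ∀ i j, ‖B i j - B₀ i j‖ < ε / (2 * (N + 1)))
    (hB1 : ∀ i j, ‖B i j‖ ≤ 1) (hA1 : ∀ i j, ‖A₀ i j‖ ≤ 1) (i j : Fin N) :
    ‖(A * B) i j - (A₀ * B₀) i j‖ < ε := by
  rw [Matrix.mul_apply, Matrix.mul_apply, ← Finset.sum_sub_distrib]
  have h : ∀ k, ‖A i k * B k j - A₀ i k * B₀ k j‖ ≤ ε / (N + 1) := fun k => by
    calc ‖A i k * B k j - A₀ i k * B₀ k j‖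
        = ‖(A i k - A₀ i k) * B k j + A₀ i k * (B k j - B₀ k j)‖ := by ring_nf
      _ ≤ ‖A i k - A₀ i k‖ * ‖B k j‖ + ‖A₀ i k‖ * ‖B k j - B₀ k j‖ := by
          rw [← norm_mul, ← norm_mul]; exact norm_add_le _ _
      _ ≤ ε / (2 * (N + 1)) * 1 + 1 * (ε / (2 * (N + 1))) := by
          gcongr
          · exact (hA i k).le
          · exact hB1 k j
          · exact hA1 i k
          · exact (hB k j).le
      _ = ε / (N + 1) := by field_simp; ring
  calc _ ≤ ∑ _k : Fin N, ε / (N + 1) := norm_sum_le_of_le _ fun k _ => h k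
    _ = N * (ε / (N + 1)) := by simp
    _ < ε := by
      rw [mul_div_assoc', div_lt_iff₀ (by positivity)]
      nlinarith

theorem Mesh.norm_transfer_apply_le {N : ℕ} {P : Type} {resp : P → ℝ → ℂ} {w : ℝ}
    (h : ∀ p, ‖resp p w‖ = 1) (M : Mesh N P) (i j : Fin N) : ‖M.transfer resp w i j‖ ≤ 1 :=
  entry_norm_bound_of_unitary (M.transfer_mem_unitaryGroup h) i j

theorem Element.norm_transfer_apply_le {N : ℕ} {P : Type} {resp : P → ℝ → ℂ} {w : ℝ}
    (h : ∀ p, ‖resp p w‖ = 1) (e : Element N P) (i j : Fin N) : ‖e.transfer resp w i j‖ ≤ 1 :=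
  entry_norm_bound_of_unitary (e.transfer_mem_unitaryGroup h) i j

/-- If the phase shifters of a mesh are approximated by cavity chains then so is the mesh. -/
theorem Mesh.exists_replaces {N : ℕ} {a b : ℝ} {M : Mesh N (ℝ → ℝ)}
    (hM : M.AllSingle (ChainApprox (Set.Icc a b))) {ε ε₀ : ℝ} (hε : 0 < ε) (hε₀ : 0 < ε₀) :
    ∃ M' : Mesh N (List Cavity), List.Forall₂ (Replaces a b ε₀) M M' ∧
      ∀ w ∈ Set.Icc a b, ∀ i j,
        ‖M'.transfer chainResponse w i j - M.transfer shifterResponse w i j‖ < ε := by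
  induction M generalizing ε with
  | nil => exact ⟨[], .nil, fun w _ i j => by simpa [Mesh.transfer] using hε⟩
  | cons e M ih =>
    have hδ : 0 < ε / (2 * ((N : ℝ) + 1)) := by positivity
    obtain ⟨M', hr, h⟩ := ih (fun m p hp => hM m p (List.mem_cons_of_mem _ hp)) hδ
    have key : ∃ e' : Element N (List Cavity), Replaces a b ε₀ e e' ∧ ∀ w ∈ Set.Icc a b, ∀ i j,
        ‖e'.transfer chainResponse w i j - e.transfer shifterResponse w i j‖
          < ε / (2 * ((N : ℝ) + 1)) := by
      cases e with
      | splitter m n hmn =>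
        exact ⟨_, .splitter m n hmn, fun w _ i j => by simpa [Element.transfer] using hδ⟩
      | single m φ =>
        -- The tolerance `ε₀` per device stays fixed, while `ε` shrinks along the induction.
        obtain ⟨C, hC⟩ := hM m φ (by simp) (min ε₀ (ε / (2 * ((N : ℝ) + 1)))) (lt_min hε₀ hδ)
        refine ⟨_, .single m φ C fun w hw => (hC w hw).trans_le (min_le_left _ _),
          fun w hw i j => ?_⟩
        have := (hC w hw).trans_le (min_le_right _ _)
        simp only [Element.transfer, onMode, diagonal_apply]
        split_ifs <;> simp_all
    obtain ⟨e', hre, he⟩ := key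
    refine ⟨e' :: M', .cons hre hr, fun w hw i j => ?_⟩
    rw [Mesh.transfer_cons, Mesh.transfer_cons]
    exact norm_mul_apply_sub_lt hε (he w hw) (h w hw)
      (M'.norm_transfer_apply_le fun C => norm_chainResponse C w)
      (e.norm_transfer_apply_le fun φ => norm_shifterResponse φ w) i j

theorem Mesh.transfer_map_single {N : ℕ} {P : Type} (resp : P → ℝ → ℂ) (g : Fin N → P)
    (l : List (Fin N)) (hl : l.Nodup) (w : ℝ) :
    Mesh.transfer resp (l.map fun i => Element.single i (g i)) w =
      diagonal fun i => if i ∈ l then resp (g i) w else 1 := by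
  induction l with
  | nil => simp [Mesh.transfer]
  | cons k l ih =>
    rw [List.nodup_cons] at hl
    rw [List.map_cons, Mesh.transfer_cons, ih hl.2, Element.transfer, onMode,
      diagonal_mul_diagonal]
    congr 1
    funext i
    by_cases hik : i = k
    · subst hik
      simp [hl.1]
    · simp [hik]

/-- If the phase shifters of a mesh are approximated by cavity chains up to reference chains then
the mesh is approximated, up to a common reference chain, by a mesh with cavity chains. -/
theorem Mesh.exists_approx {N : ℕ} {K : Set ℝ} {M : Mesh N (ℝ → ℝ)}
    (hM : M.AllSingle (RelApprox K)) {ε : ℝ} (hε : 0 < ε) :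
    ∃ (D : List Cavity) (M' : Mesh N (List Cavity)), ∀ w ∈ K, ∀ i j,
      ‖M'.transfer chainResponse w i j - chainResponse D w * M.transfer shifterResponse w i j‖
        < ε := by
  induction M generalizing ε with
  | nil => exact ⟨[], [], fun w _ i j => by simpa [Mesh.transfer, chainResponse] using hε⟩
  | cons e M ih =>
    have hδ : 0 < ε / (2 * ((N : ℝ) + 1)) := by positivity
    obtain ⟨D, M', h⟩ := ih (fun m p hp => hM m p (List.mem_cons_of_mem _ hp)) hδ
    have key : ∃ (D : List Cavity) (M' : Mesh N (List Cavity)), ∀ w ∈ K, ∀ i j,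
        ‖M'.transfer chainResponse w i j - (chainResponse D w • e.transfer shifterResponse w) i j‖
          < ε / (2 * ((N : ℝ) + 1)) := by
      cases e with
      | splitter m n hmn =>
        refine ⟨[], [.splitter m n hmn], fun w _ i j => ?_⟩
        simpa [Mesh.transfer, Element.transfer, chainResponse] using hδ
      | single m φ =>
        obtain ⟨C, D, hC⟩ := hM m φ (by simp) _ hδ
        -- The reference chain is placed on every other mode, so that it becomes a scalar factor,
        -- which commutes with the rest of the mesh.
        refine ⟨D, (Finset.univ.toList).map fun i => .single i (if i = m then C else D),
          fun w hw i j => ?_⟩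
        have := hC w hw
        rw [Mesh.transfer_map_single _ _ _ (Finset.nodup_toList _)]
        simp only [Element.transfer, onMode, diagonal_apply, Matrix.smul_apply, smul_eq_mul]
        split_ifs <;> simp_all
    obtain ⟨D₁, M₁, h₁⟩ := key
    refine ⟨D₁ ++ D, M₁ ++ M', fun w hw i j => ?_⟩
    have h2 : chainResponse (D₁ ++ D) w * Mesh.transfer shifterResponse (e :: M) w i j =
        ((chainResponse D₁ w • e.transfer shifterResponse w) *
          (chainResponse D w • Mesh.transfer shifterResponse M w)) i j := by
      rw [chainResponse_append, Mesh.transfer_cons, smul_mul_smul_comm, Matrix.smul_apply,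
        smul_eq_mul]
    rw [h2, Mesh.transfer_append]
    refine norm_mul_apply_sub_lt hε (h₁ w hw) (h w hw)
      (M'.norm_transfer_apply_le fun C => norm_chainResponse C w) (fun i j => ?_) i j
    rw [Matrix.smul_apply, norm_smul, norm_chainResponse, one_mul]
    exact e.norm_transfer_apply_le (fun φ => norm_shifterResponse φ w) i j

/-! ### Passive systems as cascades of single cavities -/

/-- The phase `φ` is real-analytic and approximated by cavity chains, without any reference
chain, on every band. -/
def CavityPhase (φ : ℝ → ℝ) : Prop :=
  ContDiff ℝ ω φ ∧ ∀ a b : ℝ, ChainApprox (Set.Icc a b) φ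

theorem cavityPhase_const (θ : ℝ) : CavityPhase fun _ => θ :=
  ⟨contDiff_const, fun _ _ => .const (fun _ hw => abs_le_max_abs_abs hw.1 hw.2) θ⟩

theorem cavityPhase_cavity (c : Cavity) :
    CavityPhase fun w => 2 * Real.arctan ((w + c.Δ) / c.γ) :=
  ⟨contDiff_const.mul (Real.contDiff_arctan.comp ((contDiff_id.add contDiff_const).div_const _)),
    fun _ _ => .cavity c⟩

variable {N : ℕ}

theorem Realizable.const {A : Matrix (Fin N) (Fin N) ℂ} (hA : A ∈ unitaryGroup (Fin N) ℂ) :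
    Realizable CavityPhase fun _ => A :=
  (realizable_const hA).mono fun _ ⟨θ, hθ⟩ => hθ ▸ cavityPhase_const θ

/-- The Blaschke–Potapov factor with pole `m` and direction `c`. -/
theorem realizable_potapov {c : Fin N → ℂ} (hc : c ≠ 0) {m : ℂ}
    (hm : m + star m = star c ⬝ᵥ c) :
    Realizable CavityPhase fun w : ℝ =>
      1 - (m - Complex.I * w)⁻¹ • vecMulVec c (star c) := by
  obtain ⟨s, -⟩ := Function.ne_iff.1 hc
  obtain ⟨A, hA, ρ, hρ, hAc⟩ := exists_unitary_mulVec_eq_single s hc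
  have hA1 : Aᴴ * A = 1 := mem_unitaryGroup_iff'.1 hA
  have hAs : Aᴴ ∈ unitaryGroup (Fin N) ℂ := Unitary.star_mem hA
  have hρm : m + star m = (ρ : ℂ) * ρ := by
    have h1 : star (A *ᵥ c) ⬝ᵥ (A *ᵥ c) = star c ⬝ᵥ c := by
      rw [star_mulVec, dotProduct_mulVec, vecMul_vecMul, hA1, vecMul_one]
    rw [hm, ← h1, hAc]
    simp
  have hre : m.re = ρ ^ 2 / 2 := by
    have := congrArg Complex.re hρm
    simp at this
    linarith
  -- In the rotated basis only mode `s` is affected. As `m + star m = ρ²`, its factor is `-(star m +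
  -- iw)/(m - iw)`: a cavity with `γ = Re m`, `Δ = -Im m`, and a constant phase `π` for the sign.
  let cav : Cavity := ⟨m.re, by rw [hre]; positivity, -m.im⟩
  have key : Realizable CavityPhase fun w : ℝ =>
      onMode s (1 - (m - Complex.I * w)⁻¹ * (ρ * ρ)) := by
    convert! (Realizable.shifter s (cavityPhase_const Real.pi)).mul
      (Realizable.shifter s (cavityPhase_cavity cav)) using 2 with w
    rw [onMode_mul, ← cav.response_eq_shifterResponse]
    congr 1
    have hpi : shifterResponse (fun _ => Real.pi) w = -1 := by
      rw [shifterResponse, mul_comm, Complex.exp_pi_mul_I]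
    have h0 := cav.denominator_ne_zero w
    rw [hpi, Cavity.response]
    have hm' : (cav.γ : ℂ) - Complex.I * ((w : ℂ) + cav.Δ) = m - Complex.I * w := by
      apply Complex.ext <;> simp [cav, sub_eq_add_neg, add_comm]
    have hm'' : (cav.γ : ℂ) + Complex.I * ((w : ℂ) + cav.Δ) = star m + Complex.I * w := by
      apply Complex.ext <;> simp [cav, add_comm]
    rw [hm'] at h0
    rw [hm'', hm']
    field_simp
    linear_combination hρm
  convert! ((Realizable.const hAs).mul key).mul (Realizable.const hA) using 2 with w
  have hE : onMode s (1 - (m - Complex.I * w)⁻¹ * (ρ * ρ)) =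
      1 - (m - Complex.I * w)⁻¹ • vecMulVec (A *ᵥ c) (star (A *ᵥ c)) := by
    rw [hAc]
    ext i j
    simp only [onMode, diagonal_apply, Matrix.sub_apply, one_apply, Matrix.smul_apply,
      vecMulVec_apply, smul_eq_mul, Pi.star_apply, Pi.single_apply]
    by_cases hi : i = s <;> by_cases hj : j = s <;> by_cases hij : i = j <;> simp_all
  have hV : vecMulVec (A *ᵥ c) (star (A *ᵥ c)) = A * vecMulVec c (star c) * Aᴴ := by
    rw [star_mulVec, mul_vecMulVec, vecMulVec_mul]
  rw [hE, hV, mul_sub, sub_mul, mul_one, hA1, mul_smul_comm, smul_mul_assoc]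
  congr 2
  calc vecMulVec c (star c) = (Aᴴ * A) * vecMulVec c (star c) * (Aᴴ * A) := by
        rw [hA1, one_mul, mul_one]
    _ = _ := by simp only [mul_assoc]

/-- One step of the cascade realization: the first state is an eigenvector of the drift. -/
theorem realizable_of_triangular {n : ℕ} {M : Matrix (Fin (n + 1)) (Fin (n + 1)) ℂ}
    {C : Matrix (Fin N) (Fin (n + 1)) ℂ} {X : ℝ → Matrix (Fin (n + 1)) (Fin N) ℂ}
    (hM : M + Mᴴ = Cᴴ * C)
    (hX : ∀ w : ℝ, (M - (Complex.I * (w : ℂ)) • (1 : Matrix _ _ ℂ)) * X w = Cᴴ)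
    (h0 : ∀ i : Fin n, M i.succ 0 = 0)
    (ih : ∀ (M : Matrix (Fin n) (Fin n) ℂ) (C : Matrix (Fin N) (Fin n) ℂ)
      (X : ℝ → Matrix (Fin n) (Fin N) ℂ), M + Mᴴ = Cᴴ * C →
      (∀ w : ℝ, (M - (Complex.I * (w : ℂ)) • (1 : Matrix _ _ ℂ)) * X w = Cᴴ) →
      Realizable CavityPhase fun w => 1 - C * X w) :
    Realizable CavityPhase fun w => 1 - C * X w := by
  set c : Fin N → ℂ := fun a => C a 0 with hc
  set C' : Matrix (Fin N) (Fin n) ℂ := C.submatrix id Fin.succ with hC'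
  set M' : Matrix (Fin n) (Fin n) ℂ := M.submatrix Fin.succ Fin.succ with hM'
  set X' : ℝ → Matrix (Fin n) (Fin N) ℂ := fun w => (X w).submatrix Fin.succ id with hX'
  have hMe : ∀ i j, M i j + star (M j i) = ∑ k, star (C k i) * C k j := fun i j => by
    have := congrFun (congrFun hM i) j
    rwa [Matrix.add_apply, Matrix.mul_apply] at this
  have hXe : ∀ (w : ℝ) i b, ∑ k, (M i k - Complex.I * w * (1 : Matrix _ _ ℂ) i k) * X w k b =
      star (C b i) := fun w i b => by
    have := congrFun (congrFun (hX w) i) b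
    rwa [Matrix.mul_apply] at this
  have hsub : Realizable CavityPhase fun w => 1 - C' * X' w := by
    refine ih M' C' X' ?_ fun w => ?_
    · ext i j
      rw [Matrix.add_apply, Matrix.mul_apply]
      exact hMe i.succ j.succ
    · ext i b
      rw [Matrix.mul_apply]
      have := hXe w i.succ b
      rw [Fin.sum_univ_succ, h0, one_apply_ne (Fin.succ_ne_zero i), mul_zero, sub_zero, zero_mul,
        zero_add] at this
      rw [conjTranspose_apply, hC', submatrix_apply, id, ← this]
      refine Finset.sum_congr rfl fun k _ => ?_
      simp [hM', hX', one_apply]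
  -- Row 0 of `M + Mᴴ = Cᴴ * C`, where the entries of `M` below the corner vanish.
  have hrow : star c ᵥ* C' = fun j => M 0 j.succ := by
    funext j
    have := hMe 0 j.succ
    rw [h0, star_zero, add_zero] at this
    rw [this]
    rfl
  have hCX : ∀ w, C * X w = vecMulVec c (X w 0) + C' * X' w := fun w => by
    ext a b
    rw [Matrix.add_apply, Matrix.mul_apply, Matrix.mul_apply, Fin.sum_univ_succ, vecMulVec_apply]
    rfl
  by_cases hc0 : c = 0
  -- An uncoupled first state does not contribute to the output.
  · convert! hsub using 3 with w
    rw [hCX, hc0, zero_vecMulVec, zero_add]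
  · have hm : M 0 0 + star (M 0 0) = star c ⬝ᵥ c := hMe 0 0
    convert! (realizable_potapov hc0 hm).mul hsub using 2 with w
    have hne : M 0 0 - Complex.I * w ≠ 0 := fun h => by
      have h1 : star c ⬝ᵥ c = 0 := by
        rw [← hm, sub_eq_zero.1 h]
        simp
      open scoped ComplexOrder in exact hc0 (dotProduct_star_self_eq_zero.1 h1)
    -- Solving row 0 for the first state shows that `1 - C X` is the Potapov factor times `1 - C'
    -- X'`.
    have hX0 : X w 0 = (M 0 0 - Complex.I * w)⁻¹ • (star c ᵥ* (1 - C' * X' w)) := by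
      rw [vecMul_sub, vecMul_one, ← vecMul_vecMul, hrow]
      funext b
      rw [Pi.smul_apply, Pi.sub_apply, smul_eq_mul, eq_inv_mul_iff_mul_eq₀ hne, eq_sub_iff_add_eq]
      have := hXe w 0 b
      rw [Fin.sum_univ_succ, one_apply_eq, mul_one] at this
      rw [Pi.star_apply, ← this]
      congr 1
      change ∑ k, M 0 k.succ * X' w k b = _
      refine Finset.sum_congr rfl fun k _ => ?_
      simp [hX', one_apply_ne (Fin.succ_ne_zero k).symm]
    rw [hCX, sub_mul, one_mul, smul_mul_assoc, vecMulVec_mul, hX0, vecMulVec_smul]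
    abel

/-- The transfer function of a passive system with drift `M` and coupling `C` is realized
by a cascade of single cavities between constant unitaries. -/
theorem realizable_of_stateSpace {n : ℕ} (M : Matrix (Fin n) (Fin n) ℂ)
    (C : Matrix (Fin N) (Fin n) ℂ) (X : ℝ → Matrix (Fin n) (Fin N) ℂ) (hM : M + Mᴴ = Cᴴ * C)
    (hX : ∀ w : ℝ, (M - (Complex.I * (w : ℂ)) • (1 : Matrix _ _ ℂ)) * X w = Cᴴ) :
    Realizable CavityPhase fun w => 1 - C * X w := by
  -- `X` is only required to solve the linear equation, so no reduced system needs an invertibility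
  -- proof.
  induction n with
  | zero =>
    convert! Realizable.one using 2 with w
    ext i j
    simp
  | succ n ih =>
    obtain ⟨μ, hμ⟩ := Module.End.exists_eigenvalue (Matrix.toLin' M)
    obtain ⟨v, hv⟩ := hμ.exists_hasEigenvector
    have hMv : M *ᵥ v = μ • v := by simpa using hv.apply_eq_smul
    -- A unitary change of state basis preserves `C X` and the relation `M + Mᴴ = Cᴴ * C`.
    obtain ⟨A, hA, ρ, hρ, hAv⟩ := exists_unitary_mulVec_eq_single 0 hv.2
    have hA1 : Aᴴ * A = 1 := mem_unitaryGroup_iff'.1 hA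
    have hcomm : ∀ (B : Matrix (Fin (n + 1)) (Fin N) ℂ), Aᴴ * (A * B) = B := fun B => by
      rw [← Matrix.mul_assoc, hA1, Matrix.one_mul]
    have := realizable_of_triangular (M := A * M * Aᴴ) (C := C * Aᴴ) (X := fun w => A * X w)
      (by
        simp only [conjTranspose_mul, conjTranspose_conjTranspose, Matrix.mul_assoc]
        rw [← Matrix.mul_add, ← Matrix.add_mul, hM]
        simp only [Matrix.mul_assoc])
      (fun w => by
        rw [conjTranspose_mul, conjTranspose_conjTranspose, ← hX w]
        simp only [Matrix.sub_mul, Matrix.mul_sub, Matrix.mul_assoc, hcomm, Matrix.smul_mul,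
          Matrix.mul_smul, Matrix.one_mul])
      (fun i => by
        have h1 : (A * M * Aᴴ) *ᵥ (Pi.single 0 (ρ : ℂ)) = μ • Pi.single 0 (ρ : ℂ) := by
          rw [← hAv, mulVec_mulVec, Matrix.mul_assoc, hA1, Matrix.mul_one, ← mulVec_mulVec, hMv,
            mulVec_smul]
        have h2 := congrFun h1 i.succ
        rw [mulVec_single] at h2
        simp at h2
        exact h2.resolve_right hρ.ne')
      ih
    simpa only [Matrix.mul_assoc, hcomm] using this

/-- Here `M = Γ + iG` and `C = √(2Γ)`: since `G` is Hermitian, `M + Mᴴ = 2Γ`. The overall sign is a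
constant unitary. -/
theorem realizable_passiveSystem (S : PassiveSystem N) : Realizable CavityPhase S.transfer := by
  set D : Matrix (Fin N) (Fin N) ℂ := diagonal fun m => ((Real.sqrt (2 * S.γ m) : ℝ) : ℂ) with hD
  set M : Matrix (Fin N) (Fin N) ℂ := (diagonal fun m => (S.γ m : ℂ)) + Complex.I • S.G with hM
  have hDs : Dᴴ = D := by
    rw [hD, diagonal_conjTranspose]
    congr 1
    funext m
    simp
  have hMM : M + Mᴴ = diagonal fun m => ((2 * S.γ m : ℝ) : ℂ) := by
    rw [hM, conjTranspose_add, conjTranspose_smul, S.G_herm.eq, diagonal_conjTranspose]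
    ext i j
    simp only [Matrix.add_apply, Matrix.smul_apply, diagonal_apply, Pi.star_apply, smul_eq_mul]
    split_ifs
    · simp; ring
    · simp
  have hMD : M + Mᴴ = Dᴴ * D := by
    rw [hMM, hDs, hD, diagonal_mul_diagonal]
    congr 1
    funext m
    rw [← Complex.ofReal_mul, Real.mul_self_sqrt (by linarith [S.γ_pos m])]
  -- A kernel vector `v` would give `∑ 2 γ_i |v_i|² = 0`, which positive damping forbids unless `v =
  -- 0`.
  have hdet : ∀ w : ℝ, IsUnit (M - (Complex.I * (w : ℂ)) • (1 : Matrix _ _ ℂ)).det := fun w => by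
    rw [isUnit_iff_ne_zero, Ne, ← exists_mulVec_eq_zero_iff]
    rintro ⟨v, hv0, hv⟩
    set B := M - (Complex.I * (w : ℂ)) • (1 : Matrix (Fin N) (Fin N) ℂ) with hB
    have hBB : B + Bᴴ = diagonal fun m => ((2 * S.γ m : ℝ) : ℂ) := by
      rw [← hMM, hB, conjTranspose_sub, conjTranspose_smul, conjTranspose_one]
      have : star (Complex.I * (w : ℂ)) = -(Complex.I * (w : ℂ)) := by simp
      rw [this, neg_smul]
      abel
    have h1 : star v ⬝ᵥ ((B + Bᴴ) *ᵥ v) = 0 := by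
      rw [add_mulVec, dotProduct_add, hv, dotProduct_zero, zero_add, dotProduct_mulVec,
        ← star_mulVec, hv, star_zero, zero_dotProduct]
    rw [hBB] at h1
    have h2 : ∑ i, 2 * S.γ i * Complex.normSq (v i) = 0 := by
      have h3 : ((∑ i, 2 * S.γ i * Complex.normSq (v i) : ℝ) : ℂ) = 0 := by
        rw [← h1, dotProduct]
        push_cast
        refine Finset.sum_congr rfl fun i _ => ?_
        rw [mulVec_diagonal, Pi.star_apply, ← Complex.mul_conj, Complex.star_def]
        ring
      exact_mod_cast h3
    rw [Finset.sum_eq_zero_iff_of_nonneg fun i _ =>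
      mul_nonneg (by linarith [S.γ_pos i]) (Complex.normSq_nonneg _)] at h2
    refine hv0 (funext fun i => ?_)
    have h3 := h2 i (Finset.mem_univ i)
    have h4 := (S.γ_pos i).ne'
    simpa [h4] using h3
  have hneg : (-1 : Matrix (Fin N) (Fin N) ℂ) ∈ unitaryGroup (Fin N) ℂ := by
    rw [mem_unitaryGroup_iff]
    simp
  convert! (Realizable.const hneg).mul (realizable_of_stateSpace M D
    (fun w => (M - (Complex.I * (w : ℂ)) • (1 : Matrix _ _ ℂ))⁻¹ * D) hMD fun w => by
      rw [← Matrix.mul_assoc, mul_nonsing_inv _ (hdet w), Matrix.one_mul, hDs]) using 2 with w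
  rw [PassiveSystem.transfer, ← hD, ← hM, neg_one_mul, neg_sub, Matrix.mul_assoc]

theorem realizable_cascade (L : List (PassiveSystem N)) :
    Realizable CavityPhase (cascadeTransfer L) := by
  induction L with
  | nil => exact Realizable.one
  | cons S L ih =>
    convert! (realizable_passiveSystem S).mul ih using 2

end FrequencyMesh

/-! ### Assembly of the two claims -/

theorem proposition2 (N : ℕ) :
    -- every smooth, or real-analytic, frequency-dependent unitary
    (∀ r : WithTop ℕ∞, (r = ∞ ∨ r = ω) →
      ∀ U : ℝ → Matrix (Fin N) (Fin N) ℂ,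
        (∀ i j, ContDiff ℝ r fun w => U w i j) →
        (∀ w, U w ∈ Matrix.unitaryGroup (Fin N) ℂ) →
        ∃ M : FrequencyMesh.Mesh N (ℝ → ℝ),
          M.AllSingle (fun φ => ContDiff ℝ r φ) ∧
          (∀ w, M.transfer FrequencyMesh.shifterResponse w = U w) ∧
          M.AllSingle (fun φ => ∀ a b ε : ℝ, 0 < ε →
            ∃ C D : List FrequencyMesh.Cavity, ∀ w ∈ Set.Icc a b,
              ‖FrequencyMesh.chainResponse C w -
                FrequencyMesh.chainResponse D w * FrequencyMesh.shifterResponse φ w‖ < ε) ∧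
          ∀ a b ε : ℝ, 0 < ε →
            ∃ (D : List FrequencyMesh.Cavity)
              (M' : FrequencyMesh.Mesh N (List FrequencyMesh.Cavity)),
              ∀ w ∈ Set.Icc a b, ∀ i j,
                ‖M'.transfer FrequencyMesh.chainResponse w i j -
                  FrequencyMesh.chainResponse D w * U w i j‖ < ε) ∧
    -- every transfer function of a passive system, or of a cascade of such systems
    (∀ L : List (FrequencyMesh.PassiveSystem N),
      ∃ M : FrequencyMesh.Mesh N (ℝ → ℝ),
        M.AllSingle (fun φ => ContDiff ℝ ω φ) ∧
        (∀ w, M.transfer FrequencyMesh.shifterResponse w = FrequencyMesh.cascadeTransfer L w) ∧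
        ∀ a b ε : ℝ, 0 < ε →
          ∃ M' : FrequencyMesh.Mesh N (List FrequencyMesh.Cavity),
            List.Forall₂ (FrequencyMesh.Replaces a b ε) M M' ∧
            ∀ w ∈ Set.Icc a b, ∀ i j,
              ‖M'.transfer FrequencyMesh.chainResponse w i j -
                FrequencyMesh.cascadeTransfer L w i j‖ < ε) := by
  refine ⟨fun r hr U hU hu => ?_, fun L => ?_⟩
  · have h1 : 1 ≤ r := by
      rcases hr with rfl | rfl
      · exact_mod_cast le_top
      · exact le_top
    obtain ⟨M, hM, hMU⟩ := FrequencyMesh.realizable_of_contDiff h1 hU hu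
    have happ : ∀ a b : ℝ, M.AllSingle (FrequencyMesh.RelApprox (Set.Icc a b)) := fun a b m φ h =>
      FrequencyMesh.relApprox_of_continuous (hM m φ h).continuous a b
    refine ⟨M, hM, hMU, fun m φ h a b => happ a b m φ h, fun a b ε hε => ?_⟩
    obtain ⟨D, M', h⟩ := FrequencyMesh.Mesh.exists_approx (happ a b) hε
    exact ⟨D, M', fun w hw i j => hMU w ▸ h w hw i j⟩
  · obtain ⟨M, hM, hML⟩ := FrequencyMesh.realizable_cascade L
    refine ⟨M, fun m φ h => (hM m φ h).1, hML, fun a b ε hε => ?_⟩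
    obtain ⟨M', hr, h⟩ := FrequencyMesh.Mesh.exists_replaces (a := a) (b := b)
      (fun m φ hφ => (hM m φ hφ).2 a b) hε hε
    exact ⟨M', hr, fun w hw i j => hML w ▸ h w hw i j⟩
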